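/- **Conventions.** A uniform commutative monoid is a commutative monoid with a uniformity for which addition is uniformly continuous; $Z$ is assumed Hausdorff. Let $S$ be a set, $\mathcal K,\mathcal G$ families of subsets of $S$, $X,Z$ uniform commutative monoids, $\mathcal B$ a family of subsets of $X$, $\mathcal F$ a set of functions $S\to X$, $\mathcal T$ a uniformity on $\mathcal F$, and $\mathcal F_B=\{f\in\mathcal F:\operatorname{rng} f\subseteq B\}$. Write $f\prec\alpha$ ($f$ is supported by $\alpha$) if $f=0$ off some $\kappa\in\mathcal K$ with $\kappa\subseteq\alpha$, write $\alpha=_xf$ if $f=x$ on some $\gamma\in\mathcal G$ with $\alpha\subseteq\gamma$, and let $H_x=\bigcap\{B\in\mathcal B:x\in B\}$. $\Re=(S,(\mathcal K,\mathcal G),(X,\mathcal B),(\mathcal F,\mathcal T))$ is a **Riesz system** if: (1) $\mathcal K$ is closed under finite unions; (2) $\mathcal G$ is closed under finite unions and finite intersections (including $\bigcup\emptyset=\emptyset$ in both cases, and $\bigcap\emptyset:=\bigcup\mathcal G$); (3) $\kappa\setminus\gamma\in\mathcal K$ and $\gamma\setminus\kappa\in\mathcal G$ for $\kappa\in\mathcal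 K,\gamma\in\mathcal G$; (4) if $\kappa\subseteq\gamma$ with $\kappa\in\mathcal K$, $\gamma\in\mathcal G$, then $\kappa\subseteq\gamma'\subseteq\kappa'\subseteq\gamma$ for some $\gamma'\in\mathcal G,\kappa'\in\mathcal K$; (5) $\mathcal B$ is closed under non-empty intersections and $0\in\bigcap\mathcal B$; (6) for $B,B'\in\mathcal B$ some $C\in\mathcal B$ contains $B+B'$; (7) $\bigcup\mathcal B=X$; (8) $0\in\mathcal F$, and $\mathcal F$ is a uniform commutative monoid under pointwise addition and $\mathcal T$; (9) each $f\in\mathcal F$ lies in some $\mathcal F_B$, $B\in\mathcal B$; (10) for each $f\in\mathcal F$ and each entourage $W$ of $X$ there is a finite $G\subseteq\mathcal G$ with $\bigcup G=S$ and $(f(s),f(t))\in W$ for all $s,t\in\gamma\in G$; (11) for $\kappa\in\mathcal K$, $\gamma\in\mathcal G$, $\kappa\subseteq\gamma$ and $x\in X$ there is $f\in\mathcal F_{H_x}$ with $\kappa=_xf\prec\gamma$; (12) for $B\in\mathcal B$, $T\in\mathcal T$ there is an entourage $U$ of $X$ such that, whenever $\mathcal K\ni\kappa\subseteq\gamma\in\mathcal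 G$, $f,g\in\mathcal F_B$, $f,g\prec\gamma$ and $(f(s),g(s))\in U$ for all $s\in\omega$, for some $\omega\in\mathcal G$ with $\kappa\subseteq\omega\subseteq\gamma$, there are $p,q\in\mathcal F_B$ with $p,q\prec\gamma\setminus\kappa$ and $(f+p,g+q)\in T$; (13) for $B\in\mathcal B$, finite $G\subseteq\mathcal G$, $\kappa\in\mathcal K$ with $\kappa\subseteq\bigcup G$, and $f\in\mathcal F_B$, there are $g_\gamma\in\mathcal F_B$ ($\gamma\in G$) with $g_\gamma\prec\gamma$, $\sum_{\gamma\in J}g_\gamma\in\mathcal F_B$ for all $J\subseteq G$, and $f=\sum_{\gamma\in G}g_\gamma$ on $\kappa$. A map $\ell:\mathcal F\to Z$ with $\ell(0)=0$ is a **Riesz integral** over the Riesz system $\Re$ if: $\ell(f+g)=\ell(f)+\ell(g)$ whenever $f\prec E$, $g\prec E'$ for disjoint $E,E'$ in the field of sets generated by $\mathcal K\cup\mathcal G$; for all $B\in\mathcal B$, entourages $W$ of $Z$ and disjoint sequences $(G_n)$ in $\mathcal G$ there is $m$ with $(\ell(f),\ell(f+g))\in W$ for all $n>m$ and $f,g\in\mathcal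 F_B$ with $g\prec G_n$; and, for each $B\in\mathcal B$, $\ell$ is uniformly continuous on $\mathcal F_B$ and $\ell(\mathcal F_B)$ has complete closure. For $\kappa\in\mathcal K$ let $\tau_\ell(\kappa)(x)$ be the limit of the filter base $\{\ell(f): f\in\mathcal F_{H_x},\ \kappa=_xf\prec\gamma\}$ ($\kappa\subseteq\gamma\in\mathcal G$). In $Z^X$ with pointwise convergence let $$\xi_\ell(\gamma)=\lim_{\kappa\in\mathcal K,\ \kappa\subseteq\gamma}\tau_\ell(\kappa)\quad(\gamma\in\mathcal G),\qquad \nu_\ell(\alpha)=\lim_{\gamma\in\mathcal G,\ \alpha\subseteq\gamma}\xi_\ell(\gamma)\quad(\alpha\subseteq S).$$ For $h$ from the subsets of $S$ to $Z^X$, a set $\alpha\subseteq S$ is $W$-small with respect to $(h,B)$ if there is $\gamma\in\mathcal G$ with $\alpha\subseteq\gamma$ and $\bigl(\sum_{\kappa\in K}h(\kappa)(x_\kappa),\sum_{\kappa\in K}h(\kappa)(x_\kappa+y_\kappa)\bigr)\in W$ for all finite disjoint $K\subseteq\mathcal K$ with $\bigcup K\subseteq\gamma$ and all $x,y:K\to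 B$. Let $\mathcal R_h$ be the family of all $\alpha\subseteq S$ such that for all $B\in\mathcal B$ and entourages $V$ of $Z$ there are $\kappa\in\mathcal K$, $\gamma\in\mathcal G$ with $\kappa\subseteq\alpha\subseteq\gamma$ and $\gamma\setminus\kappa$ $V$-small with respect to $(h,B)$. A set $\alpha\subseteq S$ is $U$-small with respect to $(\ell,B)$ if there is $\gamma\in\mathcal G$ with $\alpha\subseteq\gamma$ such that $(\ell(f),\ell(f+g))\in U$ for all $f,g\in\mathcal F_B$ with $g\prec\gamma$. The map $\ell$ is **$\mathcal G$-bounded** if for all entourages $U$ of $Z$, $B\in\mathcal B$, $K\in\mathcal K$ and $\mathcal G'\subseteq\mathcal G$ with $K\subseteq\bigcup\mathcal G'$ there is a finite $\mathcal H\subseteq\mathcal G'$ such that $K\setminus\bigcup\mathcal H$ is $U$-small with respect to $(\ell,B)$. **Theorem.** Let $\ell$ be a $Z$-valued Riesz integral over a Riesz system $\Re$. If $\ell$ is $\mathcal G$-bounded, then $\nu_\ell$ is $\sigma$-additive. That is: all the limits defining $\nu_\ell$ exist, $\mathcal R_{\nu_\ell}$ is a field of subsets of $S$ containing $\mathcal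 K\cup\mathcal G$, and $\nu_\ell$ is a countably additive measure on it: $\nu_\ell(\emptyset)=0$, $\nu_\ell(A\cup B)+\nu_\ell(A\cap B)=\nu_\ell(A)+\nu_\ell(B)$ for $A,B\in\mathcal R_{\nu_\ell}$, and $\nu_\ell\bigl(\bigcup_nA_n\bigr)=\sum_n\nu_\ell(A_n)$ (unconditionally convergent in $Z^X$, pointwise on $X$) for every disjoint sequence $(A_n)$ in $\mathcal R_{\nu_\ell}$ with $\bigcup_nA_n\in\mathcal R_{\nu_\ell}$. -/

import Mathlib

open Filter Topology Uniformity

/-- A uniform commutative monoid: addition is uniformly continuous on `M × M`. -/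
class IsUniformAddCommMonoid (M : Type*) [UniformSpace M] [AddCommMonoid M] : Prop where
  uniformContinuous_add : UniformContinuous fun p : M × M => p.1 + p.2

namespace RieszRep

variable {S X Z : Type*}

/-- `f` is supported by `α`: `f` vanishes off some member of `𝓚` contained in `α`. -/
def SupportedBy [Zero X] (𝓚 : Set (Set S)) (f : S → X) (α : Set S) : Prop :=
  ∃ κ ∈ 𝓚, κ ⊆ α ∧ ∀ s, s ∉ κ → f s = 0

/-- `f` equals `x` over `α`: `f` is constantly `x` on some member of `𝓖` containing `α`. -/
def EqualsOver (𝓖 : Set (Set S)) (f : S → X) (x : X) (α : Set S) : Prop :=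
  ∃ γ ∈ 𝓖, α ⊆ γ ∧ ∀ s ∈ γ, f s = x

/-- The `𝓑`-hull of a point: the intersection of all members of `𝓑` containing it. -/
def hull (𝓑 : Set (Set X)) (x : X) : Set X :=
  ⋂₀ {B | B ∈ 𝓑 ∧ x ∈ B}

/-- The members of `F` with range in `B`. -/
def inRange [AddCommMonoid X] (F : AddSubmonoid (S → X)) (B : Set X) : Set F :=
  {f | Set.range (f : S → X) ⊆ B}

/-- A Riesz system `(S, (𝓚, 𝓖), (X, 𝓑), (F, T))`. That `F` contains the zero function and is closed
under pointwise addition is part of the type of `F`. -/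
structure IsRieszSystem [UniformSpace X] [AddCommMonoid X] (𝓚 𝓖 : Set (Set S))
    (𝓑 : Set (Set X)) (F : AddSubmonoid (S → X)) (T : UniformSpace F) : Prop where
  /-- `𝓚` is closed under finite unions (in particular it contains the empty set). -/
  K_sUnion : ∀ H ⊆ 𝓚, H.Finite → ⋃₀ H ∈ 𝓚
  /-- `𝓖` is closed under finite unions (in particular it contains the empty set). -/
  G_sUnion : ∀ H ⊆ 𝓖, H.Finite → ⋃₀ H ∈ 𝓖
  /-- `𝓖` is closed under finite intersections, -/
  G_sInter : ∀ H ⊆ 𝓖, H.Finite → H.Nonempty → ⋂₀ H ∈ 𝓖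
  /-- the empty intersection being read as the union of `𝓖`. -/
  G_sInter_empty : ⋃₀ 𝓖 ∈ 𝓖
  K_diff_G : ∀ κ ∈ 𝓚, ∀ γ ∈ 𝓖, κ \ γ ∈ 𝓚
  G_diff_K : ∀ κ ∈ 𝓚, ∀ γ ∈ 𝓖, γ \ κ ∈ 𝓖
  interpolate : ∀ κ ∈ 𝓚, ∀ γ ∈ 𝓖, κ ⊆ γ →
    ∃ γ' ∈ 𝓖, ∃ κ' ∈ 𝓚, κ ⊆ γ' ∧ γ' ⊆ κ' ∧ κ' ⊆ γ
  B_sInter : ∀ C ⊆ 𝓑, C.Nonempty → ⋂₀ C ∈ 𝓑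
  zero_mem_B : ∀ B ∈ 𝓑, (0 : X) ∈ B
  B_add : ∀ B ∈ 𝓑, ∀ B' ∈ 𝓑, ∃ C ∈ 𝓑, ∀ b ∈ B, ∀ b' ∈ B', b + b' ∈ C
  B_cover : ∀ x : X, ∃ B ∈ 𝓑, x ∈ B
  uniform_add :
    @UniformContinuous (F × F) F (@instUniformSpaceProd F F T T) T (fun p => p.1 + p.2)
  range_subset : ∀ f : F, ∃ B ∈ 𝓑, f ∈ inRange F B
  /-- Every `f ∈ F` is finitely `𝓖`-partitionable. -/
  partitionable : ∀ f : F, ∀ W ∈ 𝓤 X, ∃ H ⊆ 𝓖, H.Finite ∧ ⋃₀ H = Set.univ ∧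
    ∀ γ ∈ H, ∀ s ∈ γ, ∀ t ∈ γ, ((f : S → X) s, (f : S → X) t) ∈ W
  exists_bump : ∀ κ ∈ 𝓚, ∀ γ ∈ 𝓖, κ ⊆ γ → ∀ x : X, ∃ f ∈ inRange F (hull 𝓑 x),
    SupportedBy 𝓚 (f : S → X) γ ∧ EqualsOver 𝓖 (f : S → X) x κ
  /-- Functions that are close near `κ` have extensions that are close everywhere. -/
  extend : ∀ B ∈ 𝓑, ∀ V ∈ 𝓤[T], ∃ U ∈ 𝓤 X, ∀ κ ∈ 𝓚, ∀ γ ∈ 𝓖, κ ⊆ γ →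
    ∀ f ∈ inRange F B, ∀ g ∈ inRange F B,
    SupportedBy 𝓚 (f : S → X) γ → SupportedBy 𝓚 (g : S → X) γ →
    (∃ ω ∈ 𝓖, κ ⊆ ω ∧ ω ⊆ γ ∧ ∀ s ∈ ω, ((f : S → X) s, (g : S → X) s) ∈ U) →
    ∃ p ∈ inRange F B, ∃ q ∈ inRange F B,
      SupportedBy 𝓚 (p : S → X) (γ \ κ) ∧ SupportedBy 𝓚 (q : S → X) (γ \ κ) ∧
      (f + p, g + q) ∈ V
  /-- Partitions of unity. -/
  partition : ∀ B ∈ 𝓑, ∀ H : Finset (Set S), (H : Set (Set S)) ⊆ 𝓖 →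
    ∀ κ ∈ 𝓚, κ ⊆ ⋃₀ (H : Set (Set S)) → ∀ f ∈ inRange F B,
    ∃ g : Set S → F, (∀ γ ∈ H, g γ ∈ inRange F B ∧ SupportedBy 𝓚 (g γ : S → X) γ) ∧
      (∀ J ⊆ H, ∑ γ ∈ J, g γ ∈ inRange F B) ∧
      ∀ s ∈ κ, (f : S → X) s = ∑ γ ∈ H, (g γ : S → X) s

/-- `f` and `g` are supported by disjoint members of the field generated by `𝓚 ∪ 𝓖`. -/
def Separated [Zero X] (𝓚 𝓖 : Set (Set S)) (f g : S → X) : Prop :=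
  ∃ E ∈ MeasureTheory.generateSetAlgebra (𝓚 ∪ 𝓖),
    ∃ E' ∈ MeasureTheory.generateSetAlgebra (𝓚 ∪ 𝓖),
      Disjoint E E' ∧ SupportedBy 𝓚 f E ∧ SupportedBy 𝓚 g E'

/-- The members `α` of `𝓖` such that adding a `g ∈ F_B` supported by `α` to any `f ∈ F_B` moves
`ℓ f` by at most `W`. -/
def smallOpens [AddCommMonoid X] (𝓚 𝓖 : Set (Set S)) {F : AddSubmonoid (S → X)}
    (ℓ : F → Z) (B : Set X) (W : Set (Z × Z)) : Set (Set S) :=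
  {α | α ∈ 𝓖 ∧ ∀ f ∈ inRange F B, ∀ g ∈ inRange F B,
    SupportedBy 𝓚 (g : S → X) α → (ℓ f, ℓ (f + g)) ∈ W}

/-- `ℓ` is a `Z`-valued Riesz integral over the Riesz system `(S, (𝓚, 𝓖), (X, 𝓑), (F, T))`. -/
structure IsRieszIntegral [UniformSpace X] [AddCommMonoid X] [UniformSpace Z] [AddCommMonoid Z]
    (𝓚 𝓖 : Set (Set S)) (𝓑 : Set (Set X)) (F : AddSubmonoid (S → X)) (T : UniformSpace F)
    (ℓ : F → Z) : Prop where
  system : IsRieszSystem 𝓚 𝓖 𝓑 F T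
  map_zero : ℓ 0 = 0
  map_add : ∀ f g : F, Separated 𝓚 𝓖 (f : S → X) (g : S → X) → ℓ (f + g) = ℓ f + ℓ g
  /-- `ℓ` is `s`-bounded over `𝓑`. -/
  sBounded : ∀ B ∈ 𝓑, ∀ W ∈ 𝓤 Z, ∀ γ : ℕ → Set S, (∀ n, γ n ∈ 𝓖) →
    Pairwise (fun i j => Disjoint (γ i) (γ j)) →
    ∃ m : ℕ, ∀ n > m, ∀ f ∈ inRange F B, ∀ g ∈ inRange F B,
      SupportedBy 𝓚 (g : S → X) (γ n) → (ℓ f, ℓ (f + g)) ∈ W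
  uniformContinuousOn : ∀ B ∈ 𝓑, @UniformContinuousOn F Z T _ ℓ (inRange F B)
  /-- `ℓ` maps each `F_B` onto a relatively complete subset of `Z`. -/
  relComplete : ∀ B ∈ 𝓑, IsComplete (closure (ℓ '' inRange F B))

/-- A subset `α` of `S` is `W`-small with respect to `ℓ` (and `B`): it is contained in a member of
`𝓖` such that `(ℓ f, ℓ (f + g)) ∈ W` for all `f, g ∈ F_B` with `g` supported by that member. -/
def SmallFor [AddCommMonoid X] (𝓚 𝓖 : Set (Set S)) {F : AddSubmonoid (S → X)}
    (ℓ : F → Z) (B : Set X) (W : Set (Z × Z)) (α : Set S) : Prop :=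
  ∃ γ ∈ smallOpens 𝓚 𝓖 ℓ B W, α ⊆ γ

/-- `ℓ` is `𝓖`-bounded: every cover of a `K ∈ 𝓚` by members of `𝓖` has finite subfamilies that
cover `K` up to arbitrarily small sets. -/
def GBounded [AddCommMonoid X] [UniformSpace Z] (𝓚 𝓖 : Set (Set S)) (𝓑 : Set (Set X))
    {F : AddSubmonoid (S → X)} (ℓ : F → Z) : Prop :=
  ∀ U ∈ 𝓤 Z, ∀ B ∈ 𝓑, ∀ K ∈ 𝓚, ∀ G' ⊆ 𝓖, K ⊆ ⋃₀ G' →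
    ∃ H ⊆ G', H.Finite ∧ SmallFor 𝓚 𝓖 ℓ B U (K \ ⋃₀ H)

section Measure

variable [AddCommMonoid X] [UniformSpace Z] [AddCommMonoid Z]

/-- The filter on `Z` generated by the sets `ℓ '' {f ∈ F | range f ⊆ hull x, f equals x over κ,
f is supported by γ}`, where `γ` runs through the members of `𝓖` that contain `κ`. -/
def tauFilter (𝓚 𝓖 : Set (Set S)) (𝓑 : Set (Set X)) {F : AddSubmonoid (S → X)} (ℓ : F → Z)
    (κ : Set S) (x : X) : Filter Z :=
  ⨅ γ ∈ {γ | γ ∈ 𝓖 ∧ κ ⊆ γ}, 𝓟 (ℓ '' {f | f ∈ inRange F (hull 𝓑 x) ∧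
    EqualsOver 𝓖 (f : S → X) x κ ∧ SupportedBy 𝓚 (f : S → X) γ})

/-- `τ_ℓ(κ)(x)`, for `κ ∈ 𝓚`: the limit of `tauFilter`. -/
noncomputable def tau (𝓚 𝓖 : Set (Set S)) (𝓑 : Set (Set X)) {F : AddSubmonoid (S → X)}
    (ℓ : F → Z) (κ : Set S) (x : X) : Z :=
  lim (tauFilter 𝓚 𝓖 𝓑 ℓ κ x)

/-- `ξ_ℓ(γ)`, for `γ ∈ 𝓖`: the limit in `Z^X` (pointwise on `X`) of `τ_ℓ(κ)` over the `κ ∈ 𝓚`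
contained in `γ`, directed by `⊆`. -/
noncomputable def xi (𝓚 𝓖 : Set (Set S)) (𝓑 : Set (Set X)) {F : AddSubmonoid (S → X)}
    (ℓ : F → Z) (γ : Set S) : X → Z :=
  limUnder (atTop : Filter {κ : Set S // κ ∈ 𝓚 ∧ κ ⊆ γ}) (fun κ => tau 𝓚 𝓖 𝓑 ℓ κ.1)

/-- `ν_ℓ(α)`: the limit in `Z^X` of `ξ_ℓ(γ)` over the `γ ∈ 𝓖` containing `α`, directed by `⊇`. -/
noncomputable def nu (𝓚 𝓖 : Set (Set S)) (𝓑 : Set (Set X)) {F : AddSubmonoid (S → X)}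
    (ℓ : F → Z) (α : Set S) : X → Z :=
  limUnder (atBot : Filter {γ : Set S // γ ∈ 𝓖 ∧ α ⊆ γ}) (fun γ => xi 𝓚 𝓖 𝓑 ℓ γ.1)

/-- All the limits in the definition of `ν_ℓ` exist. -/
structure NuWellDefined (𝓚 𝓖 : Set (Set S)) (𝓑 : Set (Set X)) {F : AddSubmonoid (S → X)}
    (ℓ : F → Z) : Prop where
  tauFilter_neBot : ∀ κ ∈ 𝓚, ∀ x, (tauFilter 𝓚 𝓖 𝓑 ℓ κ x).NeBot
  tau_lim : ∀ κ ∈ 𝓚, ∀ x, tauFilter 𝓚 𝓖 𝓑 ℓ κ x ≤ 𝓝 (tau 𝓚 𝓖 𝓑 ℓ κ x)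
  xi_lim : ∀ γ ∈ 𝓖, Tendsto (fun κ : {κ : Set S // κ ∈ 𝓚 ∧ κ ⊆ γ} => tau 𝓚 𝓖 𝓑 ℓ κ.1)
    atTop (𝓝 (xi 𝓚 𝓖 𝓑 ℓ γ))
  nu_lim : ∀ α : Set S, Tendsto (fun γ : {γ : Set S // γ ∈ 𝓖 ∧ α ⊆ γ} => xi 𝓚 𝓖 𝓑 ℓ γ.1)
    atBot (𝓝 (nu 𝓚 𝓖 𝓑 ℓ α))

/-- `α` is `W`-small with respect to `(h, B)`; only the values of `h` on `𝓚` matter. -/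
def SmallForMeasure (𝓚 𝓖 : Set (Set S)) (h : Set S → X → Z) (B : Set X) (W : Set (Z × Z))
    (α : Set S) : Prop :=
  ∃ γ ∈ 𝓖, α ⊆ γ ∧ ∀ K : Finset (Set S), (K : Set (Set S)) ⊆ 𝓚 →
    (K : Set (Set S)).PairwiseDisjoint id → ⋃₀ (K : Set (Set S)) ⊆ γ →
    ∀ x y : Set S → X, (∀ κ ∈ K, x κ ∈ B) → (∀ κ ∈ K, y κ ∈ B) →
      (∑ κ ∈ K, h κ (x κ), ∑ κ ∈ K, h κ (x κ + y κ)) ∈ W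

/-- The family `ℛ_h` of the subsets of `S` that are regular with respect to `(h, 𝓚, 𝓖, 𝓑)`. -/
def regularSets (𝓚 𝓖 : Set (Set S)) (𝓑 : Set (Set X)) (h : Set S → X → Z) : Set (Set S) :=
  {α | ∀ B ∈ 𝓑, ∀ V ∈ 𝓤 Z, ∃ κ ∈ 𝓚, ∃ γ ∈ 𝓖, κ ⊆ α ∧ α ⊆ γ ∧
    SmallForMeasure 𝓚 𝓖 h B V (γ \ κ)}

end Measure

/-- `h` is a countably additive measure on the field `R` of subsets of `S`. -/
structure IsCountablyAdditiveOn {M : Type*} [TopologicalSpace M] [AddCommMonoid M]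
    (h : Set S → M) (R : Set (Set S)) : Prop where
  isSetAlgebra : MeasureTheory.IsSetAlgebra R
  map_empty : h ∅ = 0
  map_union_add_inter : ∀ A ∈ R, ∀ B ∈ R, h (A ∪ B) + h (A ∩ B) = h A + h B
  hasSum : ∀ A : ℕ → Set S, (∀ n, A n ∈ R) → Pairwise (fun i j => Disjoint (A i) (A j)) →
    (⋃ n, A n) ∈ R → HasSum (fun n => h (A n)) (h (⋃ n, A n))

end RieszRep

/-!
The sets that are small with respect to `ℓ` form a filter `N` of neighbourhoods of `∅` in a
Fréchet–Nikodym topology. Since `ℓ` sends disjoint sequences of `𝓖` to `N`, every set of `𝓚 ∪ 𝓖` is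
approximable modulo `N` from inside by `𝓚` and from outside by `𝓖`. Two bumps over `κ` that live
near `κ` can be extended to close functions by corrections supported near, but off, `κ`; hence
their integrals are close, `τ_ℓ(κ)` exists, and `τ_ℓ` is additive and changes little when `κ` grows
by an `N`-small set.

Finite sums of values of `τ_ℓ` on disjoint subsets of `γ` are limits of values of `ℓ` on functions
supported by `γ`, so sets that are small for `ℓ` are small for `τ_ℓ`. One may therefore replace `N`
by the coarser filter of sets small for `τ_ℓ`, with respect to which `τ_ℓ` is still uniformly
continuous. Modulo this filter the regular sets are exactly those approximable by `𝓚` from inside,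
and `ν_ℓ` is the extension of `τ_ℓ` by continuity. Finally `𝓖`-boundedness is compactness of the
members of `𝓚` modulo small sets: it makes the tails of a disjoint sequence of regular sets small,
which turns additivity into countable additivity.
-/

namespace RieszRep

open scoped Function

variable {S X Z : Type*}

section UniformMonoid

variable {M : Type*} [UniformSpace M] [AddCommMonoid M] [IsUniformAddCommMonoid M]

theorem exists_add_mem_uniformity {W : Set (M × M)} (hW : W ∈ 𝓤 M) :
    ∃ V ∈ 𝓤 M, ∀ a b c d : M, (a, b) ∈ V → (c, d) ∈ V → (a + c, b + d) ∈ W := by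
  have h := IsUniformAddCommMonoid.uniformContinuous_add (M := M) hW
  rw [mem_map, uniformity_prod_eq_comap_prod, mem_comap] at h
  obtain ⟨t, ht, hts⟩ := h
  obtain ⟨V, hV, hVt⟩ := mem_prod_same_iff.1 ht
  exact ⟨V, hV, fun a b c d h₁ h₂ =>
    hts (show ((a, c), (b, d)) ∈ _ from hVt (Set.mk_mem_prod h₁ h₂))⟩

instance continuousAdd_of_isUniformAddCommMonoid : ContinuousAdd M :=
  ⟨IsUniformAddCommMonoid.uniformContinuous_add.continuous⟩

instance isUniformAddCommMonoid_pi {ι : Type*} : IsUniformAddCommMonoid (ι → M) :=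
  ⟨uniformContinuous_pi.2 fun i => IsUniformAddCommMonoid.uniformContinuous_add.comp
    (((Pi.uniformContinuous_proj _ i).comp uniformContinuous_fst).prodMk
      ((Pi.uniformContinuous_proj _ i).comp uniformContinuous_snd))⟩

theorem tendsto_of_add_eq {ι : Type*} {l : Filter ι} {a b : ι → M} {c : M}
    (hb : Tendsto b l (𝓝 0)) (hab : ∀ i, a i + b i = c) : Tendsto a l (𝓝 c) := by
  refine Uniform.tendsto_nhds_left.2 fun W hW => mem_map.2 ?_
  obtain ⟨V, hV, hVW⟩ := exists_add_mem_uniformity hW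
  filter_upwards [Uniform.tendsto_nhds_right.1 hb hV] with i hi
  simpa only [add_zero, hab i, Set.mem_preimage] using
    hVW (a i) (a i) 0 (b i) (refl_mem_uniformity hV) hi

end UniformMonoid

section Complete

variable {α : Type*} [UniformSpace α]

theorem cauchy_map_of_forall_exists {ι : Type*} {l : Filter ι} [l.NeBot] {f : ι → α}
    (h : ∀ W ∈ 𝓤 α, ∃ a, ∀ᶠ i in l, (a, f i) ∈ W) : Cauchy (map f l) := by
  refine ⟨inferInstance, fun W hW => ?_⟩
  obtain ⟨V, hV, hsymm, hVW⟩ := comp_symm_mem_uniformity_sets hW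
  obtain ⟨a, ha⟩ := h V hV
  have hmem : {b | (a, b) ∈ V} ∈ map f l := ha
  refine mem_of_superset (prod_mem_prod hmem hmem) ?_
  exact fun p hp => hVW ⟨a, hsymm.symm _ _ hp.1, hp.2⟩

theorem exists_tendsto_of_forall_exists {ι : Type*} {l : Filter ι} [l.NeBot] {f : ι → α}
    {C : Set α} (hC : IsComplete C) (hfC : ∀ᶠ i in l, f i ∈ C)
    (h : ∀ W ∈ 𝓤 α, ∃ a, ∀ᶠ i in l, (a, f i) ∈ W) : ∃ a, Tendsto f l (𝓝 a) :=
  let ⟨a, _, ha⟩ := hC _ (cauchy_map_of_forall_exists h) (le_principal_iff.2 hfC)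
  ⟨a, ha⟩

theorem isComplete_univ_pi {ι : Type*} {C : ι → Set α} (hC : ∀ i, IsComplete (C i)) :
    IsComplete (Set.univ.pi C) := by
  intro l hl hlC
  have hproj (i : ι) : ∃ a ∈ C i, map (Function.eval i) l ≤ 𝓝 a := by
    refine hC i _ (hl.map (Pi.uniformContinuous_proj _ i)) (le_principal_iff.2 (mem_map.2 ?_))
    filter_upwards [le_principal_iff.1 hlC] with x hx using hx i (Set.mem_univ i)
  choose a haC ha using hproj
  exact ⟨a, fun i _ => haC i, tendsto_pi_nhds.2 ha⟩

end Complete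

theorem exists_seq_of_step {C : Type*} {P : C → Prop} {R : C → C → Prop} {c₀ : C} (h₀ : P c₀)
    (hstep : ∀ c, P c → ∃ c', P c' ∧ R c c') :
    ∃ u : ℕ → C, u 0 = c₀ ∧ ∀ n, P (u n) ∧ R (u n) (u (n + 1)) := by
  choose next hP hR using hstep
  let v : ℕ → {c // P c} := fun n =>
    Nat.rec ⟨c₀, h₀⟩ (fun _ c => ⟨next c.1 c.2, hP c.1 c.2⟩) n
  exact ⟨fun n => (v n).1, rfl, fun n => ⟨(v n).2, hR (v n).1 (v n).2⟩⟩

/-- The set-theoretic axioms (1)–(4) of a Riesz system: `𝓚` and `𝓖` behave like the compact and the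
open subsets of a compact Hausdorff space. -/
structure IsPaving (𝓚 𝓖 : Set (Set S)) : Prop where
  K_empty : ∅ ∈ 𝓚
  K_union : ∀ κ ∈ 𝓚, ∀ κ' ∈ 𝓚, κ ∪ κ' ∈ 𝓚
  G_univ : Set.univ ∈ 𝓖
  G_union : ∀ γ ∈ 𝓖, ∀ γ' ∈ 𝓖, γ ∪ γ' ∈ 𝓖
  G_inter : ∀ γ ∈ 𝓖, ∀ γ' ∈ 𝓖, γ ∩ γ' ∈ 𝓖
  K_diff_G : ∀ κ ∈ 𝓚, ∀ γ ∈ 𝓖, κ \ γ ∈ 𝓚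
  G_diff_K : ∀ κ ∈ 𝓚, ∀ γ ∈ 𝓖, γ \ κ ∈ 𝓖
  interpolate : ∀ κ ∈ 𝓚, ∀ γ ∈ 𝓖, κ ⊆ γ →
    ∃ γ' ∈ 𝓖, ∃ κ' ∈ 𝓚, κ ⊆ γ' ∧ γ' ⊆ κ' ∧ κ' ⊆ γ

namespace IsPaving

variable {𝓚 𝓖 : Set (Set S)}

theorem K_biUnion (h : IsPaving 𝓚 𝓖) {ι : Type*} (s : Finset ι) {κ : ι → Set S}
    (hκ : ∀ i ∈ s, κ i ∈ 𝓚) : ⋃ i ∈ s, κ i ∈ 𝓚 := by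
  classical
  induction s using Finset.induction_on with
  | empty => simpa using h.K_empty
  | insert i s _ ih =>
    rw [Finset.set_biUnion_insert]
    exact h.K_union _ (hκ i (s.mem_insert_self i)) _
      (ih fun j hj => hκ j (Finset.mem_insert_of_mem hj))

theorem exists_disjoint_nhds (h : IsPaving 𝓚 𝓖) {κ κ' γ : Set S} (hκ : κ ∈ 𝓚) (hκ' : κ' ∈ 𝓚)
    (hγ : γ ∈ 𝓖) (hd : Disjoint κ κ') (hκγ : κ ⊆ γ) (hκγ' : κ' ⊆ γ) :
    ∃ ω ∈ 𝓖, ∃ ω' ∈ 𝓖, κ ⊆ ω ∧ κ' ⊆ ω' ∧ Disjoint ω ω' ∧ ω ⊆ γ ∧ ω' ⊆ γ := by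
  obtain ⟨ω, hω, κ₁, hκ₁, hκω, hωκ₁, hκ₁γ⟩ := h.interpolate κ hκ (γ \ κ') (h.G_diff_K κ' hκ' γ hγ)
    (Set.subset_sdiff.2 ⟨hκγ, hd⟩)
  exact ⟨ω, hω, γ \ κ₁, h.G_diff_K _ hκ₁ _ hγ, hκω,
    Set.subset_sdiff.2 ⟨hκγ', (Set.subset_sdiff.1 hκ₁γ).2.symm⟩,
    Set.disjoint_sdiff_right.mono_left hωκ₁, (hωκ₁.trans hκ₁γ).trans Set.sdiff_subset,
    Set.sdiff_subset⟩

variable {V : Set (Set S)}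

theorem exists_diff_mem_of_mem_K (h : IsPaving 𝓚 𝓖)
    (hV : ∀ α ∈ 𝓖, (∀ κ ∈ 𝓚, κ ⊆ α → ∃ ω ∈ 𝓖, κ ⊆ ω ∧ ω ∈ V) → α ∈ V)
    (hseq : ∀ γ : ℕ → Set S, (∀ n, γ n ∈ 𝓖) → Pairwise (Disjoint on γ) → ∃ n, γ n ∈ V)
    {κ : Set S} (hκ : κ ∈ 𝓚) : ∃ γ ∈ 𝓖, κ ⊆ γ ∧ γ \ κ ∈ V := by
  by_contra! hcon
  obtain ⟨u, -, hu⟩ := exists_seq_of_step (P := fun γ => γ ∈ 𝓖 ∧ κ ⊆ γ)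
    (R := fun γ γ' => γ' ⊆ γ ∧ ∃ ω ∈ 𝓖, ω ⊆ γ ∧ Disjoint ω γ' ∧ ω ∉ V)
    ⟨h.G_univ, κ.subset_univ⟩ (by
      rintro γ ⟨hγ, hκγ⟩
      have hnot := mt (hV _ (h.G_diff_K κ hκ γ hγ)) (hcon γ hγ hκγ)
      push Not at hnot
      obtain ⟨κ₁, hκ₁, hκ₁γ, hκ₁V⟩ := hnot
      obtain ⟨hκ₁γ, hd⟩ := Set.subset_sdiff.1 hκ₁γ
      obtain ⟨γ', hγ', ω, hω, hκγ', hκ₁ω, hd', hγ'γ, hωγ⟩ :=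
        h.exists_disjoint_nhds hκ hκ₁ hγ hd.symm hκγ hκ₁γ
      exact ⟨γ', ⟨hγ', hκγ'⟩, hγ'γ, ω, hω, hωγ, hd'.symm, hκ₁V ω hω hκ₁ω⟩)
  choose _ hR ω hω hωu hωd hωV using hu
  have hanti : Antitone u := antitone_nat_of_succ_le hR
  obtain ⟨n, hn⟩ := hseq ω hω <| (pairwise_disjoint_on ω).2 fun i j hij =>
    (hωd i).mono_right ((hωu j).trans (hanti hij))
  exact hωV n hn

theorem exists_diff_mem_of_mem_G (h : IsPaving 𝓚 𝓖)
    (hV : ∀ α ∈ 𝓖, (∀ κ ∈ 𝓚, κ ⊆ α → ∃ ω ∈ 𝓖, κ ⊆ ω ∧ ω ∈ V) → α ∈ V)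
    (hseq : ∀ γ : ℕ → Set S, (∀ n, γ n ∈ 𝓖) → Pairwise (Disjoint on γ) → ∃ n, γ n ∈ V)
    {γ : Set S} (hγ : γ ∈ 𝓖) : ∃ κ ∈ 𝓚, κ ⊆ γ ∧ γ \ κ ∈ V := by
  by_contra! hcon
  obtain ⟨u, -, hu⟩ := exists_seq_of_step (P := fun κ => κ ∈ 𝓚 ∧ κ ⊆ γ)
    (R := fun κ κ' => κ ⊆ κ' ∧ ∃ ω ∈ 𝓖, ω ⊆ κ' ∧ Disjoint ω κ ∧ ω ∉ V)
    ⟨h.K_empty, γ.empty_subset⟩ (by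
      rintro κ ⟨hκ, hκγ⟩
      have hnot := mt (hV _ (h.G_diff_K κ hκ γ hγ)) (hcon κ hκ hκγ)
      push Not at hnot
      obtain ⟨κ₁, hκ₁, hκ₁γ, hκ₁V⟩ := hnot
      obtain ⟨ω, hω, κ₂, hκ₂, hκ₁ω, hωκ₂, hκ₂γ⟩ :=
        h.interpolate κ₁ hκ₁ _ (h.G_diff_K κ hκ γ hγ) hκ₁γ
      obtain ⟨hκ₂γ, hd⟩ := Set.subset_sdiff.1 hκ₂γ
      exact ⟨κ ∪ κ₂, ⟨h.K_union κ hκ κ₂ hκ₂, Set.union_subset hκγ hκ₂γ⟩, Set.subset_union_left,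
        ω, hω, hωκ₂.trans Set.subset_union_right, hd.mono_left hωκ₂, hκ₁V ω hω hκ₁ω⟩)
  choose _ hR ω hω hωu hωd hωV using hu
  have hmono : Monotone u := monotone_nat_of_le_succ hR
  obtain ⟨n, hn⟩ := hseq ω hω <| (pairwise_disjoint_on ω).2 fun i j hij =>
    ((hωd j).mono_right ((hωu i).trans (hmono hij))).symm
  exact hωV n hn

end IsPaving

/-- A filter of subsets of `S` whose sets are the neighbourhoods of `∅` in a Fréchet–Nikodym
topology: smallness passes to subsets and to unions of two sets. It is moreover required that small
sets be contained in small members of `𝓖`. -/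
structure IsNikodym (𝓖 : Set (Set S)) (N : Filter (Set S)) : Prop where
  empty_mem : ∀ V ∈ N, ∅ ∈ V
  exists_union : ∀ V ∈ N, ∃ U ∈ N, ∀ α ∈ U, ∀ β ∈ U, ∀ δ ⊆ α ∪ β, δ ∈ V
  exists_superset : ∀ V ∈ N, ∃ U ∈ N, ∀ α ∈ U, ∃ γ ∈ 𝓖, α ⊆ γ ∧ γ ∈ V

namespace IsNikodym

variable {𝓖 : Set (Set S)} {N : Filter (Set S)} {V : Set (Set S)}

theorem exists_subset (h : IsNikodym 𝓖 N) (hV : V ∈ N) : ∃ U ∈ N, ∀ α ∈ U, ∀ δ ⊆ α, δ ∈ V := by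
  obtain ⟨U, hU, hUV⟩ := h.exists_union V hV
  exact ⟨U, hU, fun α hα δ hδ => hUV α hα α hα δ (hδ.trans Set.subset_union_left)⟩

theorem exists_biUnion (h : IsNikodym 𝓖 N) (hV : V ∈ N) :
    ∃ U : ℕ → Set (Set S), (∀ n, U n ∈ N) ∧
      ∀ (n : ℕ) (α : ℕ → Set S), (∀ i < n, α i ∈ U i) → ∀ δ ⊆ ⋃ i < n, α i, δ ∈ V := by
  obtain ⟨U, hU₀, hU⟩ := exists_seq_of_step (P := (· ∈ N))
    (R := fun V U => ∀ α ∈ U, ∀ β ∈ U, ∀ δ ⊆ α ∪ β, δ ∈ V) hV h.exists_union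
  have key (n : ℕ) : ∀ (m : ℕ) (α : ℕ → Set S), (∀ i < n, α i ∈ U (m + 1 + i)) →
      ∀ δ ⊆ ⋃ i < n, α i, δ ∈ U m := by
    induction n with
    | zero =>
      intro m α _ δ hδ
      simp only [Nat.not_lt_zero, Set.iUnion_of_empty, Set.iUnion_empty, Set.subset_empty_iff] at hδ
      exact hδ ▸ h.empty_mem _ (hU m).1
    | succ n ih =>
      intro m α hα δ hδ
      have hshift : ⋃ i < n, α (i + 1) ∈ U (m + 1) := ih (m + 1) (fun i => α (i + 1))
        (fun i hi => add_assoc (m + 1) 1 i ▸ add_comm i 1 ▸ hα (i + 1) (Nat.succ_lt_succ hi)) _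
        subset_rfl
      rw [Set.biUnion_lt_succ'] at hδ
      exact (hU m).2 _ (hα 0 n.succ_pos) _ hshift δ hδ
  refine ⟨fun n => U (n + 1), fun n => (hU _).1, fun n α hα => ?_⟩
  exact hU₀ ▸ key n 0 α fun i hi => by simpa only [zero_add, add_comm] using hα i hi

end IsNikodym

/-- A paving on which every set is regular and disjoint open sets are eventually small, smallness
being measured by the Fréchet–Nikodym filter `N`. -/
structure IsRegularPaving (𝓚 𝓖 : Set (Set S)) (N : Filter (Set S)) : Prop
    extends IsPaving 𝓚 𝓖, IsNikodym 𝓖 N where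
  outer : ∀ κ ∈ 𝓚, ∀ V ∈ N, ∃ γ ∈ 𝓖, κ ⊆ γ ∧ γ \ κ ∈ V
  inner : ∀ γ ∈ 𝓖, ∀ V ∈ N, ∃ κ ∈ 𝓚, κ ⊆ γ ∧ γ \ κ ∈ V
  exhaustive : ∀ γ : ℕ → Set S, (∀ n, γ n ∈ 𝓖) → Pairwise (Disjoint on γ) → Tendsto γ atTop N

namespace IsRegularPaving

variable {𝓚 𝓖 : Set (Set S)} {N : Filter (Set S)}

theorem coarsen (h : IsRegularPaving 𝓚 𝓖 N) {N' : Filter (Set S)} (hN' : IsNikodym 𝓖 N')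
    (hle : N ≤ N') : IsRegularPaving 𝓚 𝓖 N' where
  toIsPaving := h.toIsPaving
  toIsNikodym := hN'
  outer κ hκ V hV := h.outer κ hκ V (hle hV)
  inner γ hγ V hV := h.inner γ hγ V (hle hV)
  exhaustive γ hγ hd := (h.exhaustive γ hγ hd).mono_right hle

theorem exists_superset_sdiff (h : IsRegularPaving 𝓚 𝓖 N) {V : Set (Set S)} (hV : V ∈ N) :
    ∃ U ∈ N, ∀ κ ∈ 𝓚, ∀ α : Set S, α \ κ ∈ U → ∃ γ ∈ 𝓖, α ⊆ γ ∧ γ \ κ ∈ V := by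
  obtain ⟨V', hV', hV'V⟩ := h.exists_union V hV
  obtain ⟨U, hU, hUV'⟩ := h.exists_superset V' hV'
  refine ⟨U, hU, fun κ hκ α hα => ?_⟩
  obtain ⟨γ, hγ, hαγ, hγV'⟩ := hUV' _ hα
  obtain ⟨ω, hω, hκω, hωV'⟩ := h.outer κ hκ V' hV'
  refine ⟨ω ∪ γ, h.G_union ω hω γ hγ, ?_, hV'V _ hωV' _ hγV' _ ?_⟩
  · exact (Set.sdiff_subset_iff.1 hαγ).trans (Set.union_subset_union_left γ hκω)
  · rw [Set.union_sdiff_distrib]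
    exact Set.union_subset_union_right _ Set.sdiff_subset

theorem tendsto_of_disjoint_K (h : IsRegularPaving 𝓚 𝓖 N) {κ : ℕ → Set S} (hκ : ∀ n, κ n ∈ 𝓚)
    (hd : Pairwise (Disjoint on κ)) : Tendsto κ atTop N := by
  refine fun V hV => mem_map.2 ?_
  obtain ⟨U, hU, hUV⟩ := h.exists_union V hV
  obtain ⟨U', hU', hU'U⟩ := h.exists_biUnion hU
  have hnhd (n : ℕ) : ∃ γ ∈ 𝓖, ∃ κ' ∈ 𝓚, κ n ⊆ γ ∧ γ ⊆ κ' ∧ κ' \ κ n ∈ U' n := by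
    obtain ⟨V', hV', hV'U'⟩ := h.exists_subset (hU' n)
    obtain ⟨ω, hω, hκω, hωV'⟩ := h.outer (κ n) (hκ n) V' hV'
    obtain ⟨γ, hγ, κ', hκ', hκγ, hγκ', hκ'ω⟩ := h.interpolate (κ n) (hκ n) ω hω hκω
    exact ⟨γ, hγ, κ', hκ', hκγ, hγκ', hV'U' _ hωV' _ (Set.sdiff_subset_sdiff_left hκ'ω)⟩
  choose γ hγ κ' hκ' hκγ hγκ' hsmall using hnhd
  let ω (n : ℕ) : Set S := γ n \ ⋃ i ∈ Finset.range n, κ' i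
  have hω (n : ℕ) : ω n ∈ 𝓖 := h.G_diff_K _ (h.K_biUnion _ fun i _ => hκ' i) _ (hγ n)
  have hωd : Pairwise (Disjoint on ω) := (pairwise_disjoint_on ω).2 fun i j hij =>
    Set.disjoint_left.2 fun s hsi hsj =>
      hsj.2 (Set.mem_biUnion (Finset.mem_range.2 hij) (hγκ' i hsi.1))
  filter_upwards [(h.exhaustive ω hω hωd).eventually_mem hU] with n hn
  refine hUV _ hn _ (hU'U n (fun i => κ' i \ κ i) (fun i _ => hsmall i) _ subset_rfl) _ ?_
  intro s hs
  by_cases hsκ' : s ∈ ⋃ i ∈ Finset.range n, κ' i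
  · obtain ⟨i, hi, hsi⟩ := Set.mem_iUnion₂.1 hsκ'
    have hin := Finset.mem_range.1 hi
    exact Or.inr (Set.mem_biUnion hin ⟨hsi, Set.disjoint_right.1 (hd hin.ne) hs⟩)
  · exact Or.inl ⟨hκγ n hs, hsκ'⟩

theorem exists_minimal_superset (h : IsRegularPaving 𝓚 𝓖 N) (α : Set S) {V : Set (Set S)}
    (hV : V ∈ N) : ∃ γ₀ ∈ 𝓖, α ⊆ γ₀ ∧ ∀ γ ∈ 𝓖, α ⊆ γ → γ₀ \ γ ∈ V := by
  obtain ⟨U, hU, hUV⟩ := h.exists_union V hV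
  by_contra! hcon
  obtain ⟨u, -, hu⟩ := exists_seq_of_step (P := fun γ => γ ∈ 𝓖 ∧ α ⊆ γ)
    (R := fun γ γ' => γ' ⊆ γ ∧ γ \ γ' ∉ V) ⟨h.G_univ, α.subset_univ⟩ (by
      rintro γ ⟨hγ, hαγ⟩
      obtain ⟨γ', hγ', hαγ', hγγ'⟩ := hcon γ hγ hαγ
      exact ⟨γ ∩ γ', ⟨h.G_inter γ hγ γ' hγ', Set.subset_inter hαγ hαγ'⟩, Set.inter_subset_left,
        by rwa [Set.sdiff_self_inter]⟩)
  choose hP hR hnot using hu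
  have hanti : Antitone u := antitone_nat_of_succ_le hR
  choose κ hκ hκu hκU using fun n => h.inner (u n) (hP n).1 U hU
  have hd : Pairwise (Disjoint on fun n => κ n \ u (n + 1)) :=
    (pairwise_disjoint_on _).2 fun i j hij => Set.disjoint_left.2 fun s hsi hsj =>
      hsi.2 (hanti (Nat.succ_le_of_lt hij) (hκu j hsj.1))
  have hlim := h.tendsto_of_disjoint_K (fun n => h.K_diff_G _ (hκ n) _ (hP (n + 1)).1) hd
  obtain ⟨n, hn⟩ := (hlim.eventually_mem hU).exists
  refine hnot n (hUV _ (hκU n) _ hn _ fun s hs => ?_)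
  by_cases hsκ : s ∈ κ n
  · exact Or.inr ⟨hsκ, hs.2⟩
  · exact Or.inl ⟨hs.1, hsκ⟩

end IsRegularPaving

section Limits

variable {M : Type*} [UniformSpace M]

/-- `f α` and `g β` are uniformly close for `α ∈ 𝓐` and `β ∈ 𝓒` with `α ⊆ β` and `N`-small
difference `β \ α`. -/
def CloseOnSmallDiff (N : Filter (Set S)) (𝓐 𝓒 : Set (Set S)) (f g : Set S → M) : Prop :=
  ∀ W ∈ 𝓤 M, ∃ V ∈ N, ∀ α ∈ 𝓐, ∀ β ∈ 𝓒, α ⊆ β → β \ α ∈ V → (f α, g β) ∈ W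

theorem closeOnSmallDiff_iff_tendsto {N : Filter (Set S)} {𝓐 𝓒 : Set (Set S)} {f g : Set S → M} :
    CloseOnSmallDiff N 𝓐 𝓒 f g ↔ Tendsto (fun p : Set S × Set S => (f p.1, g p.2))
      (comap (fun p => p.2 \ p.1) N ⊓ 𝓟 {p | p.1 ∈ 𝓐 ∧ p.2 ∈ 𝓒 ∧ p.1 ⊆ p.2}) (𝓤 M) := by
  rw [((N.basis_sets.comap fun p : Set S × Set S => p.2 \ p.1).inf_principal _).tendsto_left_iff]
  refine forall₂_congr fun W _ => exists_congr fun V => and_congr_right fun _ =>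
    ⟨fun h p hp => h _ hp.2.1 _ hp.2.2.1 hp.2.2.2 hp.1, fun h α hα β hβ hαβ hV => ?_⟩
  exact h (x := (α, β)) ⟨hV, hα, hβ, hαβ⟩

theorem closeOnSmallDiff_pi {ι : Type*} {N : Filter (Set S)} {𝓐 𝓒 : Set (Set S)}
    {f g : Set S → ι → M} (h : ∀ i, CloseOnSmallDiff N 𝓐 𝓒 (f · i) (g · i)) :
    CloseOnSmallDiff N 𝓐 𝓒 f g := by
  rw [closeOnSmallDiff_iff_tendsto, Pi.uniformity, tendsto_iInf]
  exact fun i => tendsto_comap_iff.2 (closeOnSmallDiff_iff_tendsto.1 (h i))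

variable [AddCommMonoid M]

/-- The limit of `τ κ` over the `κ ∈ 𝓚` contained in `γ`, directed by `⊆`. -/
noncomputable def innerLimit (𝓚 : Set (Set S)) (τ : Set S → M) (γ : Set S) : M :=
  limUnder (atTop : Filter {κ : Set S // κ ∈ 𝓚 ∧ κ ⊆ γ}) (fun κ => τ κ.1)

/-- The limit of `innerLimit 𝓚 τ γ` over the `γ ∈ 𝓖` containing `α`, directed by `⊇`. -/
noncomputable def extension (𝓚 𝓖 : Set (Set S)) (τ : Set S → M) (α : Set S) : M :=
  limUnder (atBot : Filter {γ : Set S // γ ∈ 𝓖 ∧ α ⊆ γ}) (fun γ => innerLimit 𝓚 τ γ.1)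

/-- An additive set function on `𝓚` that is uniformly continuous with respect to the
Fréchet–Nikodym filter `N` of a regular paving, with relatively complete range. -/
structure IsTightContent (𝓚 𝓖 : Set (Set S)) (N : Filter (Set S)) (τ : Set S → M) : Prop
    extends IsRegularPaving 𝓚 𝓖 N where
  map_empty : τ ∅ = 0
  map_union : ∀ κ ∈ 𝓚, ∀ κ' ∈ 𝓚, Disjoint κ κ' → τ (κ ∪ κ') = τ κ + τ κ'
  close : CloseOnSmallDiff N 𝓚 𝓚 τ τ
  complete : ∃ C, IsComplete C ∧ ∀ κ ∈ 𝓚, τ κ ∈ C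

namespace IsPaving

variable {𝓚 𝓖 : Set (Set S)}

theorem neBot_atTop (h : IsPaving 𝓚 𝓖) (γ : Set S) :
    (atTop : Filter {κ : Set S // κ ∈ 𝓚 ∧ κ ⊆ γ}).NeBot := by
  have : Nonempty {κ : Set S // κ ∈ 𝓚 ∧ κ ⊆ γ} := ⟨⟨∅, h.K_empty, Set.empty_subset _⟩⟩
  have : IsDirectedOrder {κ : Set S // κ ∈ 𝓚 ∧ κ ⊆ γ} := ⟨fun κ κ' =>
    ⟨⟨κ.1 ∪ κ'.1, h.K_union _ κ.2.1 _ κ'.2.1, Set.union_subset κ.2.2 κ'.2.2⟩,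
      Set.subset_union_left, Set.subset_union_right⟩⟩
  infer_instance

theorem neBot_atBot (h : IsPaving 𝓚 𝓖) (α : Set S) :
    (atBot : Filter {γ : Set S // γ ∈ 𝓖 ∧ α ⊆ γ}).NeBot := by
  have : Nonempty {γ : Set S // γ ∈ 𝓖 ∧ α ⊆ γ} := ⟨⟨Set.univ, h.G_univ, Set.subset_univ _⟩⟩
  have : IsCodirectedOrder {γ : Set S // γ ∈ 𝓖 ∧ α ⊆ γ} := ⟨fun γ γ' =>
    ⟨⟨γ.1 ∩ γ'.1, h.G_inter _ γ.2.1 _ γ'.2.1, Set.subset_inter γ.2.2 γ'.2.2⟩,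
      Set.inter_subset_left, Set.inter_subset_right⟩⟩
  infer_instance

end IsPaving

namespace IsTightContent

variable {𝓚 𝓖 : Set (Set S)} {N : Filter (Set S)} {τ : Set S → M}

theorem tendsto_innerLimit (h : IsTightContent 𝓚 𝓖 N τ) {γ : Set S} (hγ : γ ∈ 𝓖) :
    Tendsto (fun κ : {κ : Set S // κ ∈ 𝓚 ∧ κ ⊆ γ} => τ κ.1) atTop (𝓝 (innerLimit 𝓚 τ γ)) := by
  have := h.neBot_atTop γ
  obtain ⟨C, hC, hτC⟩ := h.complete
  refine tendsto_nhds_limUnder <| exists_tendsto_of_forall_exists hC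
    (Eventually.of_forall fun κ : {κ // κ ∈ 𝓚 ∧ κ ⊆ γ} => hτC κ.1 κ.2.1) fun W hW => ?_
  obtain ⟨V, hV, hVW⟩ := h.close W hW
  obtain ⟨U, hU, hUV⟩ := h.exists_subset hV
  obtain ⟨κ, hκ, hκγ, hκU⟩ := h.inner γ hγ U hU
  refine ⟨τ κ, (eventually_ge_atTop ⟨κ, hκ, hκγ⟩).mono fun κ' hκ' => ?_⟩
  exact hVW κ hκ κ' κ'.2.1 hκ' (hUV _ hκU _ (Set.sdiff_subset_sdiff_left κ'.2.2))

theorem close_innerLimit (h : IsTightContent 𝓚 𝓖 N τ) :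
    CloseOnSmallDiff N 𝓚 𝓖 τ (innerLimit 𝓚 τ) := by
  intro W hW
  obtain ⟨W', ⟨hW', hclosed⟩, hW'W⟩ := uniformity_hasBasis_closed.mem_iff.1 hW
  obtain ⟨V, hV, hVW⟩ := h.close W' hW'
  obtain ⟨U, hU, hUV⟩ := h.exists_subset hV
  refine ⟨U, hU, fun κ hκ γ hγ hκγ hsmall => hW'W ?_⟩
  have := h.neBot_atTop γ
  refine hclosed.mem_of_tendsto (tendsto_const_nhds.prodMk_nhds (h.tendsto_innerLimit hγ)) <|
    (eventually_ge_atTop ⟨κ, hκ, hκγ⟩).mono fun κ' hκ' => ?_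
  exact hVW κ hκ κ' κ'.2.1 hκ' (hUV _ hsmall _ (Set.sdiff_subset_sdiff_left κ'.2.2))

theorem close_innerLimit_innerLimit (h : IsTightContent 𝓚 𝓖 N τ) :
    CloseOnSmallDiff N 𝓖 𝓖 (innerLimit 𝓚 τ) (innerLimit 𝓚 τ) := by
  intro W hW
  obtain ⟨W', hW', hsymm, hW'W⟩ := comp_symm_mem_uniformity_sets hW
  obtain ⟨V, hV, hVW⟩ := h.close_innerLimit W' hW'
  obtain ⟨U, hU, hUV⟩ := h.exists_union V hV
  refine ⟨U, hU, fun γ hγ γ' hγ' hγγ' hsmall => ?_⟩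
  obtain ⟨κ, hκ, hκγ, hκU⟩ := h.inner γ hγ U hU
  have hκV : γ \ κ ∈ V := hUV _ hκU _ hκU _ Set.subset_union_left
  have hκV' : γ' \ κ ∈ V := hUV _ hsmall _ hκU _ (sdiff_triangle γ' γ κ)
  exact hW'W ⟨τ κ, hsymm.symm _ _ (hVW κ hκ γ hγ hκγ hκV),
    hVW κ hκ γ' hγ' (hκγ.trans hγγ') hκV'⟩

variable [T2Space M]

theorem tendsto_extension (h : IsTightContent 𝓚 𝓖 N τ) (α : Set S) :
    Tendsto (fun γ : {γ : Set S // γ ∈ 𝓖 ∧ α ⊆ γ} => innerLimit 𝓚 τ γ.1) atBot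
      (𝓝 (extension 𝓚 𝓖 τ α)) := by
  have := h.neBot_atBot α
  obtain ⟨C, hC, hτC⟩ := h.complete
  have hξC (γ : {γ : Set S // γ ∈ 𝓖 ∧ α ⊆ γ}) : innerLimit 𝓚 τ γ.1 ∈ C :=
    have := h.neBot_atTop γ.1
    hC.isClosed.mem_of_tendsto (h.tendsto_innerLimit γ.2.1)
      (Eventually.of_forall fun κ => hτC κ.1 κ.2.1)
  refine tendsto_nhds_limUnder <| exists_tendsto_of_forall_exists hC
    (Eventually.of_forall hξC) fun W hW => ?_
  obtain ⟨V, hV, hVW⟩ := h.close_innerLimit_innerLimit _ (symm_le_uniformity hW)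
  obtain ⟨γ₀, hγ₀, hαγ₀, hmin⟩ := h.exists_minimal_superset α hV
  refine ⟨innerLimit 𝓚 τ γ₀, (eventually_le_atBot ⟨γ₀, hγ₀, hαγ₀⟩).mono fun γ hγ => ?_⟩
  exact hVW γ γ.2.1 γ₀ hγ₀ hγ (hmin γ γ.2.1 γ.2.2)

theorem close_extension (h : IsTightContent 𝓚 𝓖 N τ) :
    CloseOnSmallDiff N 𝓚 Set.univ τ (extension 𝓚 𝓖 τ) := by
  intro W hW
  obtain ⟨W', ⟨hW', hclosed⟩, hW'W⟩ := uniformity_hasBasis_closed.mem_iff.1 hW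
  obtain ⟨V, hV, hVW⟩ := h.close_innerLimit W' hW'
  obtain ⟨U, hU, hUV⟩ := h.exists_subset hV
  obtain ⟨U', hU', hU'U⟩ := h.exists_superset_sdiff hU
  refine ⟨U', hU', fun κ hκ α _ hκα hsmall => hW'W ?_⟩
  have := h.neBot_atBot α
  obtain ⟨γ, hγ, hαγ, hγU⟩ := hU'U κ hκ α hsmall
  refine hclosed.mem_of_tendsto (tendsto_const_nhds.prodMk_nhds (h.tendsto_extension α)) <|
    (eventually_le_atBot ⟨γ, hγ, hαγ⟩).mono fun γ' hγ' => ?_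
  exact hVW κ hκ γ' γ'.2.1 (hκα.trans γ'.2.2) (hUV _ hγU _ (Set.sdiff_subset_sdiff_left hγ'))

theorem tendsto_extension_zero (h : IsTightContent 𝓚 𝓖 N τ) :
    Tendsto (extension 𝓚 𝓖 τ) N (𝓝 0) := by
  refine Uniform.tendsto_nhds_right.2 fun W hW => mem_map.2 ?_
  obtain ⟨V, hV, hVW⟩ := h.close_extension W hW
  filter_upwards [hV] with α hα
  have := hVW ∅ h.K_empty α trivial α.empty_subset (by rwa [Set.sdiff_empty])
  rwa [h.map_empty] at this

theorem extension_eq (h : IsTightContent 𝓚 𝓖 N τ) {κ : Set S} (hκ : κ ∈ 𝓚) :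
    extension 𝓚 𝓖 τ κ = τ κ := by
  refine (eq_of_uniformity fun {W} hW => ?_).symm
  obtain ⟨V, hV, hVW⟩ := h.close_extension W hW
  exact hVW κ hκ κ trivial subset_rfl (by rw [Set.sdiff_self]; exact h.empty_mem V hV)

end IsTightContent

end Limits

theorem union_sdiff_union_subset (α β κ κ' : Set S) :
    (α ∪ β) \ (κ ∪ κ') ⊆ α \ κ ∪ β \ κ' := by
  rw [Set.union_sdiff_distrib]
  exact Set.union_subset_union (Set.sdiff_subset_sdiff_right Set.subset_union_left)
    (Set.sdiff_subset_sdiff_right Set.subset_union_right)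

/-- The sets that can be approximated from inside by members of `𝓚` up to `N`-small sets. -/
def approximableSets (𝓚 : Set (Set S)) (N : Filter (Set S)) : Set (Set S) :=
  {α | ∀ V ∈ N, ∃ κ ∈ 𝓚, κ ⊆ α ∧ α \ κ ∈ V}

/-- The filter of the members of `𝓚` that approximate `α` from inside. -/
def innerFilter (𝓚 : Set (Set S)) (N : Filter (Set S)) (α : Set S) : Filter (Set S) :=
  comap (α \ ·) N ⊓ 𝓟 {κ | κ ∈ 𝓚 ∧ κ ⊆ α}

/-- Every cover of a `κ ∈ 𝓚` by members of `𝓖` has finite subfamilies covering `κ` up to `N`-small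
sets. -/
def IsAlmostCompact (𝓚 𝓖 : Set (Set S)) (N : Filter (Set S)) : Prop :=
  ∀ V ∈ N, ∀ κ ∈ 𝓚, ∀ G ⊆ 𝓖, κ ⊆ ⋃₀ G → ∃ H ⊆ G, H.Finite ∧ κ \ ⋃₀ H ∈ V

namespace IsRegularPaving

variable {𝓚 𝓖 : Set (Set S)} {N : Filter (Set S)}

theorem mem_approximableSets_of_mem_K (h : IsRegularPaving 𝓚 𝓖 N) {κ : Set S} (hκ : κ ∈ 𝓚) :
    κ ∈ approximableSets 𝓚 N := fun V hV =>
  ⟨κ, hκ, subset_rfl, by rw [Set.sdiff_self]; exact h.empty_mem V hV⟩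

theorem exists_sandwich (h : IsRegularPaving 𝓚 𝓖 N) {α : Set S} (hα : α ∈ approximableSets 𝓚 N)
    {V : Set (Set S)} (hV : V ∈ N) : ∃ κ ∈ 𝓚, ∃ γ ∈ 𝓖, κ ⊆ α ∧ α ⊆ γ ∧ γ \ κ ∈ V := by
  obtain ⟨U, hU, hUV⟩ := h.exists_superset_sdiff hV
  obtain ⟨κ, hκ, hκα, hκU⟩ := hα U hU
  obtain ⟨γ, hγ, hαγ, hγV⟩ := hUV κ hκ α hκU
  exact ⟨κ, hκ, γ, hγ, hκα, hαγ, hγV⟩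

theorem isSetAlgebra_approximableSets (h : IsRegularPaving 𝓚 𝓖 N) :
    MeasureTheory.IsSetAlgebra (approximableSets 𝓚 N) where
  empty_mem := h.mem_approximableSets_of_mem_K h.K_empty
  compl_mem α hα V hV := by
    obtain ⟨U, hU, hUV⟩ := h.exists_union V hV
    obtain ⟨κ, -, γ, hγ, hκα, hαγ, hsmall⟩ := h.exists_sandwich hα hU
    obtain ⟨κ₀, hκ₀, -, hsmall₀⟩ := h.inner _ h.G_univ U hU
    refine ⟨κ₀ \ γ, h.K_diff_G _ hκ₀ _ hγ, fun s hs hsα => hs.2 (hαγ hsα),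
      hUV _ hsmall₀ _ hsmall _ fun s hs => ?_⟩
    by_cases hsκ₀ : s ∈ κ₀
    · exact Or.inr ⟨by_contra fun hsγ => hs.2 ⟨hsκ₀, hsγ⟩, fun hsκ => hs.1 (hκα hsκ)⟩
    · exact Or.inl ⟨Set.mem_univ s, hsκ₀⟩
  union_mem α β hα hβ V hV := by
    obtain ⟨U, hU, hUV⟩ := h.exists_union V hV
    obtain ⟨κ, hκ, hκα, hsmall⟩ := hα U hU
    obtain ⟨κ', hκ', hκβ, hsmall'⟩ := hβ U hU
    exact ⟨κ ∪ κ', h.K_union _ hκ _ hκ', Set.union_subset_union hκα hκβ,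
      hUV _ hsmall _ hsmall' _ (union_sdiff_union_subset _ _ _ _)⟩

theorem neBot_innerFilter {α : Set S} (hα : α ∈ approximableSets 𝓚 N) :
    (innerFilter 𝓚 N α).NeBot :=
  ((N.basis_sets.comap (α \ ·)).inf_principal _).neBot_iff.2 fun {V} hV =>
    let ⟨κ, hκ, hκα, hκV⟩ := hα V hV
    ⟨κ, hκV, hκ, hκα⟩

theorem tendsto_union_innerFilter (h : IsRegularPaving 𝓚 𝓖 N) (α β : Set S) :
    Tendsto (fun p : Set S × Set S => p.1 ∪ p.2) (innerFilter 𝓚 N α ×ˢ innerFilter 𝓚 N β)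
      (innerFilter 𝓚 N (α ∪ β)) := by
  refine tendsto_inf.2 ⟨tendsto_comap_iff.2 fun V hV => mem_map.2 ?_, tendsto_principal.2 ?_⟩
  · obtain ⟨U, hU, hUV⟩ := h.exists_union V hV
    refine mem_of_superset (prod_mem_prod (mem_inf_of_left (preimage_mem_comap hU))
      (mem_inf_of_left (preimage_mem_comap hU))) ?_
    exact fun p hp => hUV _ hp.1 _ hp.2 _ (union_sdiff_union_subset _ _ _ _)
  · refine mem_of_superset (prod_mem_prod (mem_inf_of_right (mem_principal_self _))
      (mem_inf_of_right (mem_principal_self _))) ?_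
    exact fun p hp => ⟨h.K_union _ hp.1.1 _ hp.2.1, Set.union_subset_union hp.1.2 hp.2.2⟩

theorem tendsto_iUnion_sdiff (h : IsRegularPaving 𝓚 𝓖 N) (hcpt : IsAlmostCompact 𝓚 𝓖 N)
    {A : ℕ → Set S} (hA : ∀ n, A n ∈ approximableSets 𝓚 N)
    (hU : ⋃ n, A n ∈ approximableSets 𝓚 N) :
    Tendsto (fun s : Finset ℕ => (⋃ n, A n) \ ⋃ i ∈ s, A i) atTop N := by
  refine fun V hV => mem_map.2 ?_
  obtain ⟨V₁, hV₁, hV₁V⟩ := h.exists_union V hV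
  obtain ⟨V₂, hV₂, hV₂V₁⟩ := h.exists_union V₁ hV₁
  obtain ⟨U, hUN, hUV₂⟩ := h.exists_biUnion hV₂
  obtain ⟨κ, hκ, hκA, hκV₁⟩ := hU V₁ hV₁
  choose κ' _ γ hγ hκA' hAγ hsmall using fun n => h.exists_sandwich (hA n) (hUN n)
  obtain ⟨H, hHγ, hHfin, hHV₂⟩ := hcpt V₂ hV₂ κ hκ (Set.range γ) (Set.range_subset_iff.2 hγ) (by
    rw [Set.sUnion_range]
    exact hκA.trans (Set.iUnion_mono hAγ))
  choose! n hn using fun β (hβ : β ∈ H) => hHγ hβ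
  obtain ⟨m, hm⟩ := (hHfin.image n).bddAbove
  have hsmall_fin : ⋃ i < m + 1, γ i \ κ' i ∈ V₂ := hUV₂ _ _ (fun i _ => hsmall i) _ subset_rfl
  filter_upwards [eventually_ge_atTop (Finset.range (m + 1))] with s hs
  refine hV₁V _ hκV₁ _ (hV₂V₁ _ hHV₂ _ hsmall_fin _ subset_rfl) _ fun t ht => ?_
  by_cases htκ : t ∈ κ
  · by_cases htH : t ∈ ⋃₀ H
    · obtain ⟨β, hβ, htβ⟩ := htH
      have hlt : n β < m + 1 := Nat.lt_succ_of_le (hm (Set.mem_image_of_mem n hβ))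
      refine Or.inr (Or.inr (Set.mem_biUnion hlt ⟨(hn β hβ).symm ▸ htβ, fun htκ' => ?_⟩))
      exact ht.2 (Set.mem_biUnion (Finset.mem_coe.2 (hs (Finset.mem_range.2 hlt))) (hκA' _ htκ'))
    · exact Or.inr (Or.inl ⟨htκ, htH⟩)
  · exact Or.inl ⟨ht.1, htκ⟩

end IsRegularPaving

namespace IsTightContent

variable {M : Type*} [UniformSpace M] [AddCommMonoid M] [T2Space M] {𝓚 𝓖 : Set (Set S)}
  {N : Filter (Set S)} {τ : Set S → M}

theorem tendsto_innerFilter (h : IsTightContent 𝓚 𝓖 N τ) (α : Set S) :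
    Tendsto τ (innerFilter 𝓚 N α) (𝓝 (extension 𝓚 𝓖 τ α)) := by
  refine Uniform.tendsto_nhds_left.2 fun W hW => mem_map.2 ?_
  obtain ⟨V, hV, hVW⟩ := h.close_extension W hW
  filter_upwards [mem_inf_of_left (preimage_mem_comap hV),
    mem_inf_of_right (mem_principal_self _)] with κ hκV hκ
  exact hVW κ hκ.1 α trivial hκ.2 hκV

variable [IsUniformAddCommMonoid M]

theorem extension_union (h : IsTightContent 𝓚 𝓖 N τ) {α β : Set S}
    (hα : α ∈ approximableSets 𝓚 N) (hβ : β ∈ approximableSets 𝓚 N) (hd : Disjoint α β) :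
    extension 𝓚 𝓖 τ (α ∪ β) = extension 𝓚 𝓖 τ α + extension 𝓚 𝓖 τ β := by
  have := IsRegularPaving.neBot_innerFilter hα
  have := IsRegularPaving.neBot_innerFilter hβ
  refine tendsto_nhds_unique
    ((h.tendsto_innerFilter _).comp (h.tendsto_union_innerFilter α β)) ?_
  refine (((h.tendsto_innerFilter α).comp tendsto_fst).add
    ((h.tendsto_innerFilter β).comp tendsto_snd)).congr' ?_
  filter_upwards [prod_mem_prod (mem_inf_of_right (mem_principal_self _))
    (mem_inf_of_right (mem_principal_self _))] with p hp
  exact (h.map_union _ hp.1.1 _ hp.2.1 (hd.mono hp.1.2 hp.2.2)).symm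

theorem extension_biUnion (h : IsTightContent 𝓚 𝓖 N τ) {A : ℕ → Set S}
    (hA : ∀ n, A n ∈ approximableSets 𝓚 N) (hd : Pairwise (Disjoint on A)) (s : Finset ℕ) :
    extension 𝓚 𝓖 τ (⋃ i ∈ s, A i) = ∑ i ∈ s, extension 𝓚 𝓖 τ (A i) := by
  classical
  induction s using Finset.induction_on with
  | empty =>
    simp only [Finset.notMem_empty, Set.iUnion_of_empty, Set.iUnion_empty, Finset.sum_empty]
    rw [h.extension_eq h.K_empty, h.map_empty]
  | insert i s hi ih =>
    rw [Finset.set_biUnion_insert, Finset.sum_insert hi, ← ih]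
    refine h.extension_union (hA i)
      (h.isSetAlgebra_approximableSets.biUnion_mem s fun j _ => hA j) ?_
    exact Set.disjoint_iUnion₂_right.2 fun j hj => hd fun hij => hi (hij ▸ hj)

theorem isCountablyAdditiveOn_extension (h : IsTightContent 𝓚 𝓖 N τ)
    (hcpt : IsAlmostCompact 𝓚 𝓖 N) :
    IsCountablyAdditiveOn (extension 𝓚 𝓖 τ) (approximableSets 𝓚 N) where
  isSetAlgebra := h.isSetAlgebra_approximableSets
  map_empty := (h.extension_eq h.K_empty).trans h.map_empty
  map_union_add_inter A hA B hB := by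
    have halg := h.isSetAlgebra_approximableSets
    have hBA := halg.sdiff_mem hB hA
    have hunion := h.extension_union hA hBA Set.disjoint_sdiff_right
    have hsplit := h.extension_union (halg.inter_mem hA hB) hBA
      (Set.disjoint_sdiff_right.mono_left Set.inter_subset_left)
    rw [Set.union_sdiff_self] at hunion
    rw [Set.inter_comm, Set.inter_union_sdiff] at hsplit
    rw [hunion, hsplit, Set.inter_comm B A, add_assoc, add_comm (extension 𝓚 𝓖 τ (B \ A))]
  hasSum A hA hd hU := by
    have halg := h.isSetAlgebra_approximableSets
    have htail := h.tendsto_extension_zero.comp (h.tendsto_iUnion_sdiff hcpt hA hU)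
    rw [HasSum, SummationFilter.unconditional_filter]
    refine tendsto_of_add_eq htail fun s => ?_
    have hs : ⋃ i ∈ s, A i ∈ approximableSets 𝓚 N := halg.biUnion_mem s fun j _ => hA j
    rw [Function.comp_apply, ← h.extension_biUnion hA hd,
      ← h.extension_union hs (halg.sdiff_mem hU hs) Set.disjoint_sdiff_right,
      Set.union_sdiff_cancel (Set.iUnion₂_subset fun i _ => Set.subset_iUnion A i)]

end IsTightContent

section SmallnessFilter

variable [UniformSpace Z]

/-- The filter of subsets of `S` generated by the classes of `(B, W)`-small sets, for `B ∈ 𝓑` and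
entourages `W` of `Z`. -/
def smallnessFilter (𝓑 : Set (Set X)) (P : Set X → Set (Z × Z) → Set S → Prop) :
    Filter (Set S) :=
  ⨅ p ∈ 𝓑 ×ˢ (𝓤 Z).sets, 𝓟 {α | P p.1 p.2 α}

theorem hasBasis_smallnessFilter {𝓑 : Set (Set X)} (hdir : DirectedOn (· ⊆ ·) 𝓑)
    (hne : 𝓑.Nonempty) {P : Set X → Set (Z × Z) → Set S → Prop}
    (hP : ∀ ⦃B C⦄, B ⊆ C → ∀ ⦃V W⦄, V ⊆ W → ∀ α, P C V α → P B W α) :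
    (smallnessFilter 𝓑 P).HasBasis (· ∈ 𝓑 ×ˢ (𝓤 Z).sets) fun p => {α | P p.1 p.2 α} := by
  refine hasBasis_biInf_principal (fun p hp q hq => ?_) (hne.prod ⟨_, univ_mem⟩)
  obtain ⟨C, hC, hpC, hqC⟩ := hdir p.1 hp.1 q.1 hq.1
  exact ⟨(C, p.2 ∩ q.2), ⟨hC, inter_mem hp.2 hq.2⟩, hP hpC Set.inter_subset_left,
    hP hqC Set.inter_subset_right⟩

theorem smallSets_mem_smallnessFilter {𝓑 : Set (Set X)} (P : Set X → Set (Z × Z) → Set S → Prop)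
    {B : Set X} (hB : B ∈ 𝓑) {W : Set (Z × Z)} (hW : W ∈ 𝓤 Z) :
    {α | P B W α} ∈ smallnessFilter 𝓑 P :=
  mem_iInf_of_mem (B, W) (mem_iInf_of_mem ⟨hB, hW⟩ (mem_principal_self _))

end SmallnessFilter

section Variation

variable [AddCommMonoid X] [AddCommMonoid Z] {𝓚 𝓖 : Set (Set S)} {τ : Set S → X → Z}

/-- The condition on `γ` in the definition of `SmallForMeasure`. -/
def HasVariationWithin (𝓚 : Set (Set S)) (τ : Set S → X → Z) (B : Set X) (W : Set (Z × Z))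
    (γ : Set S) : Prop :=
  ∀ K : Finset (Set S), (K : Set (Set S)) ⊆ 𝓚 →
    (K : Set (Set S)).PairwiseDisjoint id → ⋃₀ (K : Set (Set S)) ⊆ γ →
    ∀ x y : Set S → X, (∀ κ ∈ K, x κ ∈ B) → (∀ κ ∈ K, y κ ∈ B) →
      (∑ κ ∈ K, τ κ (x κ), ∑ κ ∈ K, τ κ (x κ + y κ)) ∈ W

theorem HasVariationWithin.mono {B C : Set X} (hBC : B ⊆ C) {V W : Set (Z × Z)} (hVW : V ⊆ W)
    {γ : Set S} (h : HasVariationWithin 𝓚 τ C V γ) : HasVariationWithin 𝓚 τ B W γ :=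
  fun K hK hd hKγ x y hx hy =>
    hVW (h K hK hd hKγ x y (fun κ hκ => hBC (hx κ hκ)) fun κ hκ => hBC (hy κ hκ))

theorem SmallForMeasure.mono {B C : Set X} (hBC : B ⊆ C) {V W : Set (Z × Z)} (hVW : V ⊆ W)
    {α β : Set S} (hαβ : α ⊆ β) (h : SmallForMeasure 𝓚 𝓖 τ C V β) :
    SmallForMeasure 𝓚 𝓖 τ B W α :=
  let ⟨γ, hγ, hβγ, hvar⟩ := h
  ⟨γ, hγ, hαβ.trans hβγ, HasVariationWithin.mono hBC hVW hvar⟩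

theorem SmallForMeasure.congr {σ : Set S → X → Z} (hστ : ∀ κ ∈ 𝓚, σ κ = τ κ) {B : Set X}
    {W : Set (Z × Z)} {α : Set S} (h : SmallForMeasure 𝓚 𝓖 σ B W α) :
    SmallForMeasure 𝓚 𝓖 τ B W α := by
  obtain ⟨γ, hγ, hαγ, hvar⟩ := h
  refine ⟨γ, hγ, hαγ, fun K hK hd hKγ x y hx hy => ?_⟩
  have hsum (z : Set S → X) : ∑ κ ∈ K, σ κ (z κ) = ∑ κ ∈ K, τ κ (z κ) :=
    Finset.sum_congr rfl fun κ hκ => by rw [hστ κ (hK hκ)]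
  rw [← hsum x, ← hsum fun κ => x κ + y κ]
  exact hvar K hK hd hKγ x y hx hy

theorem regularSets_congr [UniformSpace Z] {𝓑 : Set (Set X)} {σ : Set S → X → Z}
    (hστ : ∀ κ ∈ 𝓚, σ κ = τ κ) : regularSets 𝓚 𝓖 𝓑 σ = regularSets 𝓚 𝓖 𝓑 τ := by
  have hiff {B : Set X} {W : Set (Z × Z)} {α : Set S} :
      SmallForMeasure 𝓚 𝓖 σ B W α ↔ SmallForMeasure 𝓚 𝓖 τ B W α :=
    ⟨SmallForMeasure.congr hστ, SmallForMeasure.congr fun κ hκ => (hστ κ hκ).symm⟩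
  simp only [regularSets, hiff]

theorem HasVariationWithin.sum_mem {B : Set X} {W : Set (Z × Z)} {γ : Set S}
    (hvar : HasVariationWithin 𝓚 τ B W γ) (hempty : τ ∅ = 0) {ι : Type*} [Fintype ι]
    {κ : ι → Set S} (hκ : ∀ i, κ i ∈ 𝓚) (hd : Pairwise (Disjoint on κ)) (hκγ : ∀ i, κ i ⊆ γ)
    {x y : ι → X} (hx : ∀ i, x i ∈ B) (hy : ∀ i, y i ∈ B) :
    (∑ i, τ (κ i) (x i), ∑ i, τ (κ i) (x i + y i)) ∈ W := by
  classical
  rcases isEmpty_or_nonempty ι with _ | _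
  · simpa using hvar ∅ (by simp) (by simp) (by simp) (fun _ => 0) (fun _ => 0) (by simp) (by simp)
  -- Only the empty set can be a value of `κ` at several indices, and it contributes nothing.
  have hinv (i : ι) (hi : κ i ≠ ∅) : Function.invFun κ (κ i) = i := by
    by_contra hne
    have := hd hne
    rw [Function.onFun, Function.invFun_eq (f := κ) ⟨i, rfl⟩, disjoint_self] at this
    exact hi this
  have hsum (z : ι → X) : ∑ α ∈ Finset.univ.image κ, τ α (z (Function.invFun κ α)) =
      ∑ i, τ (κ i) (z i) := by
    rw [Finset.sum_image_of_disjoint (by rw [Set.bot_eq_empty, hempty]; rfl) (hd.set_pairwise _)]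
    refine Finset.sum_congr rfl fun i _ => ?_
    by_cases hi : κ i = ∅
    · rw [hi, hempty, Pi.zero_apply, Pi.zero_apply]
    · rw [hinv i hi]
  rw [← hsum x, ← hsum fun i => x i + y i]
  refine hvar _ ?_ ?_ ?_ (fun α => x (Function.invFun κ α)) (fun α => y (Function.invFun κ α))
    (fun _ _ => hx _) fun _ _ => hy _
  · simpa [Set.range_subset_iff] using hκ
  · rw [Finset.coe_image]
    rintro - ⟨i, -, rfl⟩ - ⟨j, -, rfl⟩ hne
    exact hd fun hij => hne (hij ▸ rfl)
  · simpa using hκγ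

end Variation

/-- The Fréchet–Nikodym filter generated by the sets that are small with respect to a set function
`τ` and the family `𝓑`. -/
def contentFilter [AddCommMonoid X] [UniformSpace Z] [AddCommMonoid Z] (𝓚 𝓖 : Set (Set S))
    (𝓑 : Set (Set X)) (τ : Set S → X → Z) : Filter (Set S) :=
  smallnessFilter 𝓑 (SmallForMeasure 𝓚 𝓖 τ)

section ContentFilter

variable [AddCommMonoid X] [UniformSpace Z] [AddCommMonoid Z] {𝓚 𝓖 : Set (Set S)}
  {𝓑 : Set (Set X)} {τ : Set S → X → Z}

theorem hasBasis_contentFilter (hdir : DirectedOn (· ⊆ ·) 𝓑) (hne : 𝓑.Nonempty) :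
    (contentFilter 𝓚 𝓖 𝓑 τ).HasBasis (· ∈ 𝓑 ×ˢ (𝓤 Z).sets)
      fun p => {α | SmallForMeasure 𝓚 𝓖 τ p.1 p.2 α} :=
  hasBasis_smallnessFilter hdir hne fun _ _ hBC _ _ hVW _ => SmallForMeasure.mono hBC hVW subset_rfl

theorem regularSets_eq_approximableSets (hdir : DirectedOn (· ⊆ ·) 𝓑) (hne : 𝓑.Nonempty)
    (h : IsRegularPaving 𝓚 𝓖 (contentFilter 𝓚 𝓖 𝓑 τ)) :
    regularSets 𝓚 𝓖 𝓑 τ = approximableSets 𝓚 (contentFilter 𝓚 𝓖 𝓑 τ) := by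
  refine Set.Subset.antisymm (fun α hα V hV => ?_) fun α hα B hB W hW =>
    h.exists_sandwich hα (smallSets_mem_smallnessFilter _ hB hW)
  obtain ⟨⟨B, W⟩, ⟨hB, hW⟩, hBW⟩ := (hasBasis_contentFilter hdir hne).mem_iff.1 hV
  obtain ⟨κ, hκ, γ, -, hκα, hαγ, hsmall⟩ := hα B hB W hW
  exact ⟨κ, hκ, hκα, hBW (hsmall.mono subset_rfl subset_rfl (Set.sdiff_subset_sdiff_left hαγ))⟩

namespace IsTightContent

variable [T2Space Z] {N : Filter (Set S)}

theorem extension_apply_zero (h : IsTightContent 𝓚 𝓖 N τ) (hzero : ∀ κ ∈ 𝓚, τ κ 0 = 0)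
    {α : Set S} (hα : α ∈ approximableSets 𝓚 N) : extension 𝓚 𝓖 τ α 0 = 0 := by
  have := IsRegularPaving.neBot_innerFilter hα
  refine tendsto_nhds_unique (tendsto_pi_nhds.1 (h.tendsto_innerFilter α) 0)
    (tendsto_const_nhds.congr' ?_)
  filter_upwards [mem_inf_of_right (mem_principal_self _)] with κ hκ using (hzero κ hκ.1).symm

variable [IsUniformAddCommMonoid Z]

theorem sum_extension_mem (h : IsTightContent 𝓚 𝓖 N τ) {B : Set X} {W : Set (Z × Z)}
    (hW : IsClosed W) {γ : Set S} (hvar : HasVariationWithin 𝓚 τ B W γ) {ι : Type*} [Fintype ι]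
    {α : ι → Set S} (hα : ∀ i, α i ∈ approximableSets 𝓚 N) (hd : Pairwise (Disjoint on α))
    (hαγ : ∀ i, α i ⊆ γ) {x y : ι → X} (hx : ∀ i, x i ∈ B) (hy : ∀ i, y i ∈ B) :
    (∑ i, extension 𝓚 𝓖 τ (α i) (x i), ∑ i, extension 𝓚 𝓖 τ (α i) (x i + y i)) ∈ W := by
  have (i : ι) := IsRegularPaving.neBot_innerFilter (hα i)
  have hlim (z : ι → X) : Tendsto (fun κ : ι → Set S => ∑ i, τ (κ i) (z i))
      (Filter.pi fun i => innerFilter 𝓚 N (α i)) (𝓝 (∑ i, extension 𝓚 𝓖 τ (α i) (z i))) :=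
    tendsto_finsetSum _ fun i _ => tendsto_pi_nhds.1 (h.tendsto_innerFilter (α i)) (z i)
      |>.comp (tendsto_eval_pi _ i)
  refine hW.mem_of_tendsto ((hlim x).prodMk_nhds (hlim fun i => x i + y i)) ?_
  have hev : ∀ᶠ κ in Filter.pi fun i => innerFilter 𝓚 N (α i), ∀ i, κ i ∈ 𝓚 ∧ κ i ⊆ α i :=
    eventually_all.2 fun i => (tendsto_eval_pi (fun i => innerFilter 𝓚 N (α i)) i).eventually_mem
      (mem_inf_of_right (mem_principal_self {κ | κ ∈ 𝓚 ∧ κ ⊆ α i}))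
  filter_upwards [hev] with κ hκ
  exact hvar.sum_mem h.map_empty (fun i => (hκ i).1)
    (fun i j hij => (hd hij).mono (hκ i).2 (hκ j).2) (fun i => (hκ i).2.trans (hαγ i)) hx hy

theorem hasVariationWithin_union (h : IsTightContent 𝓚 𝓖 N τ) {B : Set X} {V W : Set (Z × Z)}
    (hV : IsClosed V) (hVW : ∀ a b c d : Z, (a, b) ∈ V → (c, d) ∈ V → (a + c, b + d) ∈ W)
    {γ γ' : Set S} (hγ' : γ' ∈ 𝓖) (hvar : HasVariationWithin 𝓚 τ B V γ)
    (hvar' : HasVariationWithin 𝓚 τ B V γ') : HasVariationWithin 𝓚 τ B W (γ ∪ γ') := by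
  intro K hK hd hKγ x y hx hy
  have halg := h.isSetAlgebra_approximableSets
  have hκ (κ : K) : κ.1 ∈ approximableSets 𝓚 N := h.mem_approximableSets_of_mem_K (hK κ.2)
  have hsplit (z : Set S → X) : ∑ κ ∈ K, τ κ (z κ) =
      ∑ κ : K, extension 𝓚 𝓖 τ (κ \ γ') (z κ) + ∑ κ : K, extension 𝓚 𝓖 τ (κ ∩ γ') (z κ) := by
    rw [← Finset.sum_add_distrib, ← Finset.sum_coe_sort K]
    refine Finset.sum_congr rfl fun κ _ => ?_
    rw [← Pi.add_apply, ← h.extension_union (halg.sdiff_mem (hκ κ) (h.inner γ' hγ'))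
      (halg.inter_mem (hκ κ) (h.inner γ' hγ')) Set.disjoint_sdiff_inter, Set.sdiff_union_inter,
      h.extension_eq (hK κ.2)]
  have hdK : Pairwise (Disjoint on ((↑) : K → Set S)) := fun κ κ' hne =>
    hd κ.2 κ'.2 fun heq => hne (Subtype.ext heq)
  rw [hsplit x, hsplit fun κ => x κ + y κ]
  refine hVW _ _ _ _
    (h.sum_extension_mem hV hvar (fun κ => halg.sdiff_mem (hκ κ) (h.inner γ' hγ'))
      (fun κ κ' hne => (hdK hne).mono Set.sdiff_subset Set.sdiff_subset) (fun κ => ?_)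
      (fun κ => hx κ κ.2) fun κ => hy κ κ.2)
    (h.sum_extension_mem hV hvar' (fun κ => halg.inter_mem (hκ κ) (h.inner γ' hγ'))
      (fun κ κ' hne => (hdK hne).mono Set.inter_subset_left Set.inter_subset_left)
      (fun κ => Set.inter_subset_right) (fun κ => hx κ κ.2) fun κ => hy κ κ.2)
  rw [Set.sdiff_subset_iff, Set.union_comm]
  exact (Set.subset_sUnion_of_mem (Finset.mem_coe.2 κ.2)).trans hKγ

theorem isNikodym_contentFilter (h : IsTightContent 𝓚 𝓖 N τ) (hdir : DirectedOn (· ⊆ ·) 𝓑)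
    (hne : 𝓑.Nonempty) (hle : N ≤ contentFilter 𝓚 𝓖 𝓑 τ) :
    IsNikodym 𝓖 (contentFilter 𝓚 𝓖 𝓑 τ) where
  empty_mem V hV := h.empty_mem V (hle hV)
  exists_union V hV := by
    obtain ⟨⟨B, W⟩, ⟨hB, hW⟩, hBW⟩ := (hasBasis_contentFilter hdir hne).mem_iff.1 hV
    obtain ⟨W₁, hW₁, hadd⟩ := exists_add_mem_uniformity hW
    obtain ⟨W₂, ⟨hW₂, hclosed⟩, hW₂W₁⟩ := uniformity_hasBasis_closed.mem_iff.1 hW₁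
    refine ⟨_, smallSets_mem_smallnessFilter _ hB hW₂, ?_⟩
    rintro α ⟨γ, hγ, hαγ, hvar⟩ β ⟨γ', hγ', hβγ', hvar'⟩ δ hδ
    exact hBW ⟨γ ∪ γ', h.G_union γ hγ γ' hγ', hδ.trans (Set.union_subset_union hαγ hβγ'),
      h.hasVariationWithin_union hclosed
        (fun a b c d hab hcd => hadd a b c d (hW₂W₁ hab) (hW₂W₁ hcd)) hγ' hvar hvar'⟩
  exists_superset V hV := by
    obtain ⟨⟨B, W⟩, ⟨hB, hW⟩, hBW⟩ := (hasBasis_contentFilter hdir hne).mem_iff.1 hV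
    refine ⟨_, smallSets_mem_smallnessFilter _ hB hW, ?_⟩
    rintro α ⟨γ, hγ, hαγ, hvar⟩
    exact ⟨γ, hγ, hαγ, hBW ⟨γ, hγ, subset_rfl, hvar⟩⟩

theorem closeOnSmallDiff_contentFilter (h : IsTightContent 𝓚 𝓖 N τ)
    (hzero : ∀ κ ∈ 𝓚, τ κ 0 = 0) (hzero_mem : ∀ B ∈ 𝓑, (0 : X) ∈ B)
    (hcover : ∀ x : X, ∃ B ∈ 𝓑, x ∈ B) :
    CloseOnSmallDiff (contentFilter 𝓚 𝓖 𝓑 τ) 𝓚 𝓚 τ τ := by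
  refine closeOnSmallDiff_pi fun x W hW => ?_
  obtain ⟨B, hB, hx⟩ := hcover x
  obtain ⟨W₁, hW₁, hadd⟩ := exists_add_mem_uniformity hW
  obtain ⟨W₂, ⟨hW₂, hclosed⟩, hW₂W₁⟩ := uniformity_hasBasis_closed.mem_iff.1 hW₁
  refine ⟨_, smallSets_mem_smallnessFilter _ hB hW₂, ?_⟩
  rintro κ hκ κ' hκ' hκκ' ⟨γ, -, hsub, hvar⟩
  have hκN := h.mem_approximableSets_of_mem_K hκ
  have hdiff : κ' \ κ ∈ approximableSets 𝓚 N :=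
    h.isSetAlgebra_approximableSets.sdiff_mem (h.mem_approximableSets_of_mem_K hκ') hκN
  have hsmall := h.sum_extension_mem hclosed hvar (ι := Unit) (fun _ => hdiff)
    (fun i j hij => (hij rfl).elim) (fun _ => hsub) (fun _ => hzero_mem B hB) fun _ => hx
  simp only [Finset.univ_unique, Finset.sum_singleton, zero_add,
    h.extension_apply_zero hzero hdiff] at hsmall
  have hsplit := h.extension_union hκN hdiff Set.disjoint_sdiff_right
  rw [Set.union_sdiff_cancel hκκ', h.extension_eq hκ, h.extension_eq hκ'] at hsplit
  change (τ κ x, τ κ' x) ∈ W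
  have := hadd (τ κ x) _ _ _ (refl_mem_uniformity hW₁) (hW₂W₁ hsmall)
  rwa [add_zero, ← Pi.add_apply, ← hsplit] at this

theorem coarsen_contentFilter (h : IsTightContent 𝓚 𝓖 N τ) (hdir : DirectedOn (· ⊆ ·) 𝓑)
    (hzero : ∀ κ ∈ 𝓚, τ κ 0 = 0) (hzero_mem : ∀ B ∈ 𝓑, (0 : X) ∈ B)
    (hcover : ∀ x : X, ∃ B ∈ 𝓑, x ∈ B) (hle : N ≤ contentFilter 𝓚 𝓖 𝓑 τ) :
    IsTightContent 𝓚 𝓖 (contentFilter 𝓚 𝓖 𝓑 τ) τ where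
  toIsRegularPaving := h.coarsen (h.isNikodym_contentFilter hdir
    (let ⟨B, hB, _⟩ := hcover 0; ⟨B, hB⟩) hle) hle
  map_empty := h.map_empty
  map_union := h.map_union
  close := h.closeOnSmallDiff_contentFilter hzero hzero_mem hcover
  complete := h.complete

end IsTightContent

end ContentFilter

section Supports

variable [AddCommMonoid X] {𝓚 𝓖 : Set (Set S)} {F : AddSubmonoid (S → X)} {B C D : Set X}
  {f g : F} {α β : Set S}

theorem mem_inRange : f ∈ inRange F B ↔ ∀ s, (f : S → X) s ∈ B :=
  Set.range_subset_iff

theorem inRange_mono (hBC : B ⊆ C) : inRange F B ⊆ inRange F C :=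
  fun _ hf => hf.trans hBC

theorem add_mem_inRange (hadd : ∀ b ∈ B, ∀ c ∈ C, b + c ∈ D) (hf : f ∈ inRange F B)
    (hg : g ∈ inRange F C) : f + g ∈ inRange F D :=
  mem_inRange.2 fun s => hadd _ (mem_inRange.1 hf s) _ (mem_inRange.1 hg s)

theorem SupportedBy.mono {f : S → X} (hf : SupportedBy 𝓚 f α) (hαβ : α ⊆ β) :
    SupportedBy 𝓚 f β :=
  let ⟨κ, hκ, hκα, hf⟩ := hf
  ⟨κ, hκ, hκα.trans hαβ, hf⟩

theorem SupportedBy.eq_zero {f : S → X} (hf : SupportedBy 𝓚 f α) {s : S} (hs : s ∉ α) :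
    f s = 0 :=
  let ⟨_, _, hκα, hf⟩ := hf
  hf s fun hsκ => hs (hκα hsκ)

theorem add_mem_inRange_of_disjoint (hαβ : Disjoint α β) (hf : f ∈ inRange F B)
    (hg : g ∈ inRange F B) (hfα : SupportedBy 𝓚 (f : S → X) α)
    (hgβ : SupportedBy 𝓚 (g : S → X) β) : f + g ∈ inRange F B := by
  refine mem_inRange.2 fun s => ?_
  rw [AddSubmonoid.coe_add, Pi.add_apply]
  by_cases hs : s ∈ α
  · rw [hgβ.eq_zero (Set.disjoint_left.1 hαβ hs), add_zero]
    exact mem_inRange.1 hf s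
  · rw [hfα.eq_zero hs, zero_add]
    exact mem_inRange.1 hg s

theorem separated_of_disjoint (hα : α ∈ 𝓖) (hβ : β ∈ 𝓖) (hαβ : Disjoint α β)
    (hf : SupportedBy 𝓚 (f : S → X) α) (hg : SupportedBy 𝓚 (g : S → X) β) :
    Separated 𝓚 𝓖 (f : S → X) (g : S → X) :=
  ⟨α, MeasureTheory.self_subset_generateSetAlgebra (Or.inr hα), β,
    MeasureTheory.self_subset_generateSetAlgebra (Or.inr hβ), hαβ, hf, hg⟩

end Supports

theorem EqualsOver.mono {𝓖 : Set (Set S)} {f : S → X} {x : X} {α β : Set S}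
    (hf : EqualsOver 𝓖 f x β) (hαβ : α ⊆ β) : EqualsOver 𝓖 f x α :=
  let ⟨γ, hγ, hβγ, hf⟩ := hf
  ⟨γ, hγ, hαβ.trans hβγ, hf⟩

theorem hull_subset {𝓑 : Set (Set X)} {B : Set X} (hB : B ∈ 𝓑) {x : X} (hx : x ∈ B) :
    hull 𝓑 x ⊆ B :=
  Set.sInter_subset_of_mem ⟨hB, hx⟩

theorem mem_hull (𝓑 : Set (Set X)) (x : X) : x ∈ hull 𝓑 x :=
  fun _ hB => hB.2

section System

variable [UniformSpace X] [AddCommMonoid X] {𝓚 𝓖 : Set (Set S)} {𝓑 : Set (Set X)}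
  {F : AddSubmonoid (S → X)} {T : UniformSpace F}

namespace IsRieszSystem

theorem isPaving (h : IsRieszSystem 𝓚 𝓖 𝓑 F T) : IsPaving 𝓚 𝓖 where
  K_empty := Set.sUnion_empty ▸ h.K_sUnion ∅ (Set.empty_subset _) Set.finite_empty
  K_union κ hκ κ' hκ' :=
    Set.sUnion_pair κ κ' ▸ h.K_sUnion {κ, κ'} (Set.pair_subset hκ hκ') (Set.toFinite _)
  G_univ :=
    let ⟨H, hH, hfin, hu, _⟩ := h.partitionable 0 Set.univ univ_mem
    hu ▸ h.G_sUnion H hH hfin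
  G_union γ hγ γ' hγ' :=
    Set.sUnion_pair γ γ' ▸ h.G_sUnion {γ, γ'} (Set.pair_subset hγ hγ') (Set.toFinite _)
  G_inter γ hγ γ' hγ' := Set.sInter_pair γ γ' ▸
    h.G_sInter {γ, γ'} (Set.pair_subset hγ hγ') (Set.toFinite _) (Set.insert_nonempty _ _)
  K_diff_G := h.K_diff_G
  G_diff_K := h.G_diff_K
  interpolate := h.interpolate

theorem exists_add (h : IsRieszSystem 𝓚 𝓖 𝓑 F T) {B : Set X} (hB : B ∈ 𝓑) :
    ∃ C ∈ 𝓑, B ⊆ C ∧ ∀ b ∈ B, ∀ b' ∈ B, b + b' ∈ C := by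
  obtain ⟨C, hC, hBC⟩ := h.B_add B hB B hB
  exact ⟨C, hC, fun b hb => add_zero b ▸ hBC b hb 0 (h.zero_mem_B B hB), hBC⟩

theorem directedOn (h : IsRieszSystem 𝓚 𝓖 𝓑 F T) : DirectedOn (· ⊆ ·) 𝓑 := by
  intro B hB B' hB'
  obtain ⟨C, hC, hadd⟩ := h.B_add B hB B' hB'
  exact ⟨C, hC, fun b hb => add_zero b ▸ hadd b hb 0 (h.zero_mem_B B' hB'),
    fun b hb => zero_add b ▸ hadd 0 (h.zero_mem_B B hB) b hb⟩

theorem nonempty (h : IsRieszSystem 𝓚 𝓖 𝓑 F T) : 𝓑.Nonempty :=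
  let ⟨B, hB, _⟩ := h.B_cover 0
  ⟨B, hB⟩

theorem hull_mem (h : IsRieszSystem 𝓚 𝓖 𝓑 F T) (x : X) : hull 𝓑 x ∈ 𝓑 :=
  let ⟨B, hB, hx⟩ := h.B_cover x
  h.B_sInter _ (fun _ hC => hC.1) ⟨B, hB, hx⟩

theorem zero_mem_inRange (h : IsRieszSystem 𝓚 𝓖 𝓑 F T) {B : Set X} (hB : B ∈ 𝓑) :
    (0 : F) ∈ inRange F B :=
  mem_inRange.2 fun _ => h.zero_mem_B B hB

theorem supportedBy_zero (h : IsRieszSystem 𝓚 𝓖 𝓑 F T) (α : Set S) :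
    SupportedBy 𝓚 ((0 : F) : S → X) α :=
  ⟨∅, h.isPaving.K_empty, Set.empty_subset _, fun _ _ => rfl⟩

theorem supportedBy_add (h : IsRieszSystem 𝓚 𝓖 𝓑 F T) {f g : F} {α β : Set S}
    (hf : SupportedBy 𝓚 (f : S → X) α) (hg : SupportedBy 𝓚 (g : S → X) β) :
    SupportedBy 𝓚 ((f + g : F) : S → X) (α ∪ β) := by
  obtain ⟨κ, hκ, hκα, hf⟩ := hf
  obtain ⟨κ', hκ', hκβ, hg⟩ := hg
  refine ⟨κ ∪ κ', h.isPaving.K_union κ hκ κ' hκ', Set.union_subset_union hκα hκβ, fun s hs => ?_⟩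
  rw [AddSubmonoid.coe_add, Pi.add_apply, hf s fun hs' => hs (Or.inl hs'),
    hg s fun hs' => hs (Or.inr hs'), add_zero]

theorem exists_entourage_add (h : IsRieszSystem 𝓚 𝓖 𝓑 F T) {V : Set (F × F)} (hV : V ∈ 𝓤[T]) :
    ∃ V' ∈ 𝓤[T], ∀ b f g : F, (f, g) ∈ V' → (b + f, b + g) ∈ V := by
  obtain ⟨V', hV', hadd⟩ := @exists_add_mem_uniformity F T _ ⟨h.uniform_add⟩ V hV
  exact ⟨V', hV', fun b f g hfg => hadd b b f g (@refl_mem_uniformity F T b V' hV') hfg⟩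

theorem exists_add_eq_on (h : IsRieszSystem 𝓚 𝓖 𝓑 F T) {B : Set X} (hB : B ∈ 𝓑)
    {γ γ' κ : Set S} (hγ : γ ∈ 𝓖) (hγ' : γ' ∈ 𝓖) (hκ : κ ∈ 𝓚) (hκγ : κ ⊆ γ ∪ γ') {f : F}
    (hf : f ∈ inRange F B) :
    ∃ g ∈ inRange F B, ∃ g' ∈ inRange F B, g + g' ∈ inRange F B ∧
      SupportedBy 𝓚 (g : S → X) γ ∧ SupportedBy 𝓚 (g' : S → X) γ' ∧
      ∀ s ∈ κ, (f : S → X) s = ((g + g' : F) : S → X) s := by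
  classical
  obtain ⟨k, hk, hsum, hfk⟩ := h.partition B hB {γ, γ'}
    (by simpa using Set.pair_subset hγ hγ') κ hκ (by simpa using hκγ) f hf
  obtain ⟨hkB, hkγ⟩ := hk γ (by simp)
  obtain ⟨hkB', hkγ'⟩ := hk γ' (by simp)
  rcases eq_or_ne γ γ' with rfl | hne
  · refine ⟨k γ, hkB, 0, h.zero_mem_inRange hB, by rwa [add_zero], hkγ, h.supportedBy_zero γ, ?_⟩
    simpa using hfk
  · refine ⟨k γ, hkB, k γ', hkB', ?_, hkγ, hkγ', ?_⟩
    · simpa [Finset.sum_pair hne] using hsum {γ, γ'} subset_rfl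
    · simpa [Finset.sum_pair hne] using hfk

end IsRieszSystem

end System

section Small

variable [AddCommMonoid X] {𝓚 𝓖 : Set (Set S)} {F : AddSubmonoid (S → X)} {ℓ : F → Z}
  {B : Set X} {W : Set (Z × Z)} {α : Set S}

theorem SmallFor.mono {C : Set X} (hBC : B ⊆ C) {V : Set (Z × Z)} (hVW : V ⊆ W) {β : Set S}
    (hαβ : α ⊆ β) (h : SmallFor 𝓚 𝓖 ℓ C V β) : SmallFor 𝓚 𝓖 ℓ B W α := by
  obtain ⟨γ, ⟨hγ, hsmall⟩, hβγ⟩ := h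
  exact ⟨γ, ⟨hγ, fun f hf g hg hgγ =>
    hVW (hsmall f (inRange_mono hBC hf) g (inRange_mono hBC hg) hgγ)⟩, hαβ.trans hβγ⟩

theorem SmallFor.map_mem (h : SmallFor 𝓚 𝓖 ℓ B W α) {f g : F} (hf : f ∈ inRange F B)
    (hg : g ∈ inRange F B) (hgα : SupportedBy 𝓚 (g : S → X) α) : (ℓ f, ℓ (f + g)) ∈ W :=
  let ⟨_, hγ, hαγ⟩ := h
  hγ.2 f hf g hg (hgα.mono hαγ)

theorem smallFor_of_forall_subset (hα : α ∈ 𝓖)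
    (h : ∀ κ ∈ 𝓚, κ ⊆ α → ∃ ω, κ ⊆ ω ∧ SmallFor 𝓚 𝓖 ℓ B W ω) : SmallFor 𝓚 𝓖 ℓ B W α := by
  refine ⟨α, ⟨hα, fun f hf g hg hgα => ?_⟩, subset_rfl⟩
  obtain ⟨κ, hκ, hκα, hgκ⟩ := hgα
  obtain ⟨ω, hκω, hω⟩ := h κ hκ hκα
  exact hω.map_mem hf hg ⟨κ, hκ, hκω, hgκ⟩

end Small

/-- The Fréchet–Nikodym filter generated by the sets that are small with respect to `ℓ` and the
family `𝓑`. -/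
def integralFilter [AddCommMonoid X] [UniformSpace Z] (𝓚 𝓖 : Set (Set S)) (𝓑 : Set (Set X))
    {F : AddSubmonoid (S → X)} (ℓ : F → Z) : Filter (Set S) :=
  smallnessFilter 𝓑 (SmallFor 𝓚 𝓖 ℓ)

section IntegralFilter

variable [AddCommMonoid X] [UniformSpace Z] {𝓚 𝓖 : Set (Set S)} {𝓑 : Set (Set X)}
  {F : AddSubmonoid (S → X)} {ℓ : F → Z}

theorem hasBasis_integralFilter (hdir : DirectedOn (· ⊆ ·) 𝓑) (hne : 𝓑.Nonempty) :
    (integralFilter 𝓚 𝓖 𝓑 ℓ).HasBasis (· ∈ 𝓑 ×ˢ (𝓤 Z).sets)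
      fun p => {α | SmallFor 𝓚 𝓖 ℓ p.1 p.2 α} :=
  hasBasis_smallnessFilter hdir hne fun _ _ hBC _ _ hVW _ => SmallFor.mono hBC hVW subset_rfl

theorem GBounded.isAlmostCompact (h : GBounded 𝓚 𝓖 𝓑 ℓ) (hdir : DirectedOn (· ⊆ ·) 𝓑)
    (hne : 𝓑.Nonempty) : IsAlmostCompact 𝓚 𝓖 (integralFilter 𝓚 𝓖 𝓑 ℓ) := by
  intro V hV κ hκ G hG hκG
  obtain ⟨⟨B, W⟩, ⟨hB, hW⟩, hBW⟩ := (hasBasis_integralFilter hdir hne).mem_iff.1 hV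
  obtain ⟨H, hHG, hfin, hsmall⟩ := h W hW B hB κ hκ G hG hκG
  exact ⟨H, hHG, hfin, hBW hsmall⟩

end IntegralFilter

namespace IsRieszIntegral

variable [UniformSpace X] [AddCommMonoid X] [UniformSpace Z] [AddCommMonoid Z]
  {𝓚 𝓖 : Set (Set S)} {𝓑 : Set (Set X)} {F : AddSubmonoid (S → X)} {T : UniformSpace F}
  {ℓ : F → Z}

theorem exists_entourage_map (h : IsRieszIntegral 𝓚 𝓖 𝓑 F T ℓ) {B : Set X} (hB : B ∈ 𝓑)
    {W : Set (Z × Z)} (hW : W ∈ 𝓤 Z) :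
    ∃ V ∈ 𝓤[T], ∀ f ∈ inRange F B, ∀ g ∈ inRange F B, (f, g) ∈ V → (ℓ f, ℓ g) ∈ W :=
  ⟨_, mem_inf_principal.1 (mem_map.1 (h.uniformContinuousOn B hB hW)),
    fun _ hf _ hg hfg => hfg ⟨hf, hg⟩⟩

theorem exists_map_add_mem (h : IsRieszIntegral 𝓚 𝓖 𝓑 F T ℓ) {B : Set X} (hB : B ∈ 𝓑)
    {W : Set (Z × Z)} (hW : W ∈ 𝓤 Z) :
    ∃ C ∈ 𝓑, ∃ V ∈ 𝓤 Z, ∀ κ ∈ 𝓚, ∀ γ ∈ 𝓖, κ ⊆ γ → SmallFor 𝓚 𝓖 ℓ C V (γ \ κ) →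
      ∀ b ∈ inRange F B, ∀ f ∈ inRange F B, ∀ g ∈ inRange F B,
      SupportedBy 𝓚 (f : S → X) γ → SupportedBy 𝓚 (g : S → X) γ →
      (∃ ω ∈ 𝓖, κ ⊆ ω ∧ ∀ s ∈ ω, (f : S → X) s = (g : S → X) s) →
      (ℓ (b + f), ℓ (b + g)) ∈ W := by
  have hs := h.system
  obtain ⟨C, hC, hBC, haddC⟩ := hs.exists_add hB
  obtain ⟨D, hD, -, haddD⟩ := hs.exists_add hC
  obtain ⟨V, hV, hsymm, hVW⟩ := comp_comp_symm_mem_uniformity_sets hW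
  obtain ⟨V₁, hV₁, hmap⟩ := h.exists_entourage_map hD hV
  obtain ⟨V₂, hV₂, hadd⟩ := hs.exists_entourage_add hV₁
  obtain ⟨U, hU, hext⟩ := hs.extend B hB V₂ hV₂
  refine ⟨C, hC, V, hV, fun κ hκ γ hγ hκγ hsmall b hb f hf g hg hfγ hgγ => ?_⟩
  rintro ⟨ω, hω, hκω, hfg⟩
  obtain ⟨p, hp, q, hq, hpκ, hqκ, hpq⟩ := hext κ hκ γ hγ hκγ f hf g hg hfγ hgγ
    ⟨ω ∩ γ, hs.isPaving.G_inter ω hω γ hγ, Set.subset_inter hκω hκγ, Set.inter_subset_right,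
      fun s hsω => by rw [hfg s hsω.1]; exact refl_mem_uniformity hU⟩
  have hbf := add_mem_inRange haddC hb hf
  have hbg := add_mem_inRange haddC hb hg
  have hpC := inRange_mono hBC hp
  have hqC := inRange_mono hBC hq
  have hclose : (ℓ (b + f + p), ℓ (b + g + q)) ∈ V := by
    refine hmap _ (add_mem_inRange haddD hbf hpC) _ (add_mem_inRange haddD hbg hqC) ?_
    rw [add_assoc, add_assoc]
    exact hadd b _ _ hpq
  exact hVW ⟨_, ⟨_, hsmall.map_mem hbf hpC hpκ, hclose⟩,
    hsymm.symm _ _ (hsmall.map_mem hbg hqC hqκ)⟩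

theorem tendsto_integralFilter_of_disjoint (h : IsRieszIntegral 𝓚 𝓖 𝓑 F T ℓ) {γ : ℕ → Set S}
    (hγ : ∀ n, γ n ∈ 𝓖) (hd : Pairwise (Disjoint on γ)) :
    Tendsto γ atTop (integralFilter 𝓚 𝓖 𝓑 ℓ) := by
  refine (hasBasis_integralFilter h.system.directedOn h.system.nonempty).tendsto_right_iff.2 ?_
  rintro ⟨B, W⟩ ⟨hB, hW⟩
  obtain ⟨m, hm⟩ := h.sBounded B hB W hW γ hγ hd
  exact (eventually_gt_atTop m).mono fun n hn => ⟨γ n, ⟨hγ n, hm n hn⟩, subset_rfl⟩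

theorem exists_smallFor_diff_of_mem_K (h : IsRieszIntegral 𝓚 𝓖 𝓑 F T ℓ) {B : Set X} (hB : B ∈ 𝓑)
    {W : Set (Z × Z)} (hW : W ∈ 𝓤 Z) {κ : Set S} (hκ : κ ∈ 𝓚) :
    ∃ γ ∈ 𝓖, κ ⊆ γ ∧ SmallFor 𝓚 𝓖 ℓ B W (γ \ κ) :=
  h.system.isPaving.exists_diff_mem_of_mem_K (V := {α | SmallFor 𝓚 𝓖 ℓ B W α})
    (fun _ hα hsmall => smallFor_of_forall_subset hα fun κ hκ hκα =>
      let ⟨ω, _, hω⟩ := hsmall κ hκ hκα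
      ⟨ω, hω⟩)
    (fun _ hγ hd => ((h.tendsto_integralFilter_of_disjoint hγ hd).eventually
      (smallSets_mem_smallnessFilter _ hB hW)).exists) hκ

theorem exists_smallFor_diff_of_mem_G (h : IsRieszIntegral 𝓚 𝓖 𝓑 F T ℓ) {B : Set X} (hB : B ∈ 𝓑)
    {W : Set (Z × Z)} (hW : W ∈ 𝓤 Z) {γ : Set S} (hγ : γ ∈ 𝓖) :
    ∃ κ ∈ 𝓚, κ ⊆ γ ∧ SmallFor 𝓚 𝓖 ℓ B W (γ \ κ) :=
  h.system.isPaving.exists_diff_mem_of_mem_G (V := {α | SmallFor 𝓚 𝓖 ℓ B W α})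
    (fun _ hα hsmall => smallFor_of_forall_subset hα fun κ hκ hκα =>
      let ⟨ω, _, hω⟩ := hsmall κ hκ hκα
      ⟨ω, hω⟩)
    (fun _ hγ hd => ((h.tendsto_integralFilter_of_disjoint hγ hd).eventually
      (smallSets_mem_smallnessFilter _ hB hW)).exists) hγ

theorem exists_smallFor_union (h : IsRieszIntegral 𝓚 𝓖 𝓑 F T ℓ) {B : Set X} (hB : B ∈ 𝓑)
    {W : Set (Z × Z)} (hW : W ∈ 𝓤 Z) :
    ∃ C ∈ 𝓑, ∃ V ∈ 𝓤 Z, ∀ α β, SmallFor 𝓚 𝓖 ℓ C V α → SmallFor 𝓚 𝓖 ℓ C V β →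
      SmallFor 𝓚 𝓖 ℓ B W (α ∪ β) := by
  have hs := h.system
  obtain ⟨C, hC, hBC, hadd⟩ := hs.exists_add hB
  obtain ⟨V, hV, hsymm, hVW⟩ := comp_comp_symm_mem_uniformity_sets hW
  obtain ⟨D, hD, V', hV', hmap⟩ := h.exists_map_add_mem hB hV
  refine ⟨C, hC, V, hV, fun α β ⟨γ₁, h₁, hαγ⟩ ⟨γ₂, h₂, hβγ⟩ => ?_⟩
  have hγ := hs.isPaving.G_union γ₁ h₁.1 γ₂ h₂.1
  refine ⟨γ₁ ∪ γ₂, ⟨hγ, fun f hf g hg hgγ => ?_⟩, Set.union_subset_union hαγ hβγ⟩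
  obtain ⟨κ₀, hκ₀, hκ₀γ, hsmall⟩ := h.exists_smallFor_diff_of_mem_G hD hV' hγ
  obtain ⟨κ₁, hκ₁, hκ₁γ, hgκ₁⟩ := hgγ
  have hκ := hs.isPaving.K_union κ₀ hκ₀ κ₁ hκ₁
  have hκγ := Set.union_subset hκ₀γ hκ₁γ
  obtain ⟨ω, hω, κ, hκK, hκω, hωκ, hκγ'⟩ := hs.interpolate _ hκ _ hγ hκγ
  obtain ⟨g₁, hg₁, g₂, hg₂, hg₁₂, hgγ₁, hgγ₂, heq⟩ :=
    hs.exists_add_eq_on hB h₁.1 h₂.1 hκK hκγ' hg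
  have hmove₁ : (ℓ f, ℓ (f + g₁)) ∈ V :=
    h₁.2 f (inRange_mono hBC hf) g₁ (inRange_mono hBC hg₁) hgγ₁
  have hmove₂ : (ℓ (f + g₁), ℓ (f + g₁ + g₂)) ∈ V :=
    h₂.2 _ (add_mem_inRange hadd hf hg₁) g₂ (inRange_mono hBC hg₂) hgγ₂
  have hclose : (ℓ (f + g), ℓ (f + (g₁ + g₂))) ∈ V :=
    hmap _ hκ _ hγ hκγ
      (hsmall.mono subset_rfl subset_rfl (Set.sdiff_subset_sdiff_right Set.subset_union_left))
      f hf g hg _ hg₁₂ ⟨κ₁, hκ₁, hκ₁γ, hgκ₁⟩ (hs.supportedBy_add hgγ₁ hgγ₂)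
      ⟨ω, hω, hκω, fun s hsω => heq s (hωκ hsω)⟩
  rw [← add_assoc] at hclose
  exact hVW ⟨_, ⟨_, hmove₁, hmove₂⟩, hsymm.symm _ _ hclose⟩

theorem isRegularPaving (h : IsRieszIntegral 𝓚 𝓖 𝓑 F T ℓ) :
    IsRegularPaving 𝓚 𝓖 (integralFilter 𝓚 𝓖 𝓑 ℓ) := by
  have hs := h.system
  have hbasis := hasBasis_integralFilter (𝓚 := 𝓚) (𝓖 := 𝓖) (ℓ := ℓ) hs.directedOn hs.nonempty
  refine
    { toIsPaving := hs.isPaving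
      empty_mem := fun V hV => ?_
      exists_union := fun V hV => ?_
      exists_superset := fun V hV => ?_
      outer := fun κ hκ V hV => ?_
      inner := fun γ hγ V hV => ?_
      exhaustive := fun γ hγ hd => h.tendsto_integralFilter_of_disjoint hγ hd }
  all_goals obtain ⟨⟨B, W⟩, ⟨hB, hW⟩, hBW⟩ := hbasis.mem_iff.1 hV
  · obtain ⟨γ, -, -, hsmall⟩ := h.exists_smallFor_diff_of_mem_K hB hW hs.isPaving.K_empty
    exact hBW (hsmall.mono subset_rfl subset_rfl (Set.empty_subset _))
  · obtain ⟨C, hC, U, hU, hunion⟩ := h.exists_smallFor_union hB hW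
    exact ⟨_, hbasis.mem_of_mem (i := (C, U)) ⟨hC, hU⟩, fun α hα β hβ δ hδ =>
      hBW ((hunion α β hα hβ).mono subset_rfl subset_rfl hδ)⟩
  · exact ⟨_, hbasis.mem_of_mem (i := (B, W)) ⟨hB, hW⟩, fun α ⟨γ, hγ, hαγ⟩ =>
      ⟨γ, hγ.1, hαγ, hBW ⟨γ, hγ, subset_rfl⟩⟩⟩
  · obtain ⟨γ, hγ, hκγ, hsmall⟩ := h.exists_smallFor_diff_of_mem_K hB hW hκ
    exact ⟨γ, hγ, hκγ, hBW hsmall⟩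
  · obtain ⟨κ, hκ, hκγ, hsmall⟩ := h.exists_smallFor_diff_of_mem_G hB hW hγ
    exact ⟨κ, hκ, hκγ, hBW hsmall⟩

end IsRieszIntegral

section Bumps

variable [AddCommMonoid X]

/-- The `f ∈ F_B` with `κ =ₓ f ≺ γ`. -/
def bumps (𝓚 𝓖 : Set (Set S)) (F : AddSubmonoid (S → X)) (B : Set X) (κ γ : Set S) (x : X) :
    Set F :=
  {f | f ∈ inRange F B ∧ EqualsOver 𝓖 (f : S → X) x κ ∧ SupportedBy 𝓚 (f : S → X) γ}

/-- The filter on `F` generated by the sets `bumps 𝓚 𝓖 F B κ γ x` for `γ ∈ 𝓖` containing `κ`. Its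
image under `ℓ`, for `B = hull 𝓑 x`, is `tauFilter`. -/
def bumpFilter (𝓚 𝓖 : Set (Set S)) (F : AddSubmonoid (S → X)) (B : Set X) (κ : Set S) (x : X) :
    Filter F :=
  ⨅ γ ∈ {γ | γ ∈ 𝓖 ∧ κ ⊆ γ}, 𝓟 (bumps 𝓚 𝓖 F B κ γ x)

variable {𝓚 𝓖 : Set (Set S)} {F : AddSubmonoid (S → X)} {B C : Set X} {κ κ' γ γ' : Set S} {x : X}

theorem bumps_mono (hBC : B ⊆ C) (hκκ' : κ ⊆ κ') (hγγ' : γ ⊆ γ') :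
    bumps 𝓚 𝓖 F B κ' γ x ⊆ bumps 𝓚 𝓖 F C κ γ' x :=
  fun _ hf => ⟨inRange_mono hBC hf.1, hf.2.1.mono hκκ', hf.2.2.mono hγγ'⟩

theorem bumpFilter_mono (hBC : B ⊆ C) : bumpFilter 𝓚 𝓖 F B κ x ≤ bumpFilter 𝓚 𝓖 F C κ x :=
  iInf₂_mono fun _ _ => principal_mono.2 (bumps_mono hBC subset_rfl subset_rfl)

theorem IsPaving.hasBasis_bumpFilter (h : IsPaving 𝓚 𝓖) :
    (bumpFilter 𝓚 𝓖 F B κ x).HasBasis (· ∈ {γ | γ ∈ 𝓖 ∧ κ ⊆ γ})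
      fun γ => bumps 𝓚 𝓖 F B κ γ x :=
  hasBasis_biInf_principal
    (fun γ hγ γ' hγ' => ⟨γ ∩ γ', ⟨h.G_inter γ hγ.1 γ' hγ'.1, Set.subset_inter hγ.2 hγ'.2⟩,
      bumps_mono subset_rfl subset_rfl Set.inter_subset_left,
      bumps_mono subset_rfl subset_rfl Set.inter_subset_right⟩)
    ⟨Set.univ, h.G_univ, κ.subset_univ⟩

theorem IsPaving.tauFilter_eq_map (h : IsPaving 𝓚 𝓖) {𝓑 : Set (Set X)} (ℓ : F → Z) :
    tauFilter 𝓚 𝓖 𝓑 ℓ κ x = map ℓ (bumpFilter 𝓚 𝓖 F (hull 𝓑 x) κ x) := by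
  rw [bumpFilter, map_biInf_eq]
  · simp only [map_principal]
    rfl
  · exact fun γ hγ γ' hγ' => ⟨γ ∩ γ', ⟨h.G_inter γ hγ.1 γ' hγ'.1, Set.subset_inter hγ.2 hγ'.2⟩,
      principal_mono.2 (bumps_mono subset_rfl subset_rfl Set.inter_subset_left),
      principal_mono.2 (bumps_mono subset_rfl subset_rfl Set.inter_subset_right)⟩
  · exact ⟨Set.univ, h.G_univ, κ.subset_univ⟩

/-- The pairs `(ℓ f, ℓ (f + g))` for `f, g ∈ F_B` supported by `γ`. -/
def increments (𝓚 : Set (Set S)) (ℓ : F → Z) (B : Set X) (γ : Set S) : Set (Z × Z) :=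
  Set.image2 (fun f g => (ℓ f, ℓ (f + g)))
    {f | f ∈ inRange F B ∧ SupportedBy 𝓚 (f : S → X) γ}
    {g | g ∈ inRange F B ∧ SupportedBy 𝓚 (g : S → X) γ}

end Bumps

namespace IsRieszSystem

variable [UniformSpace X] [AddCommMonoid X] {𝓚 𝓖 : Set (Set S)} {𝓑 : Set (Set X)}
  {F : AddSubmonoid (S → X)} {T : UniformSpace F} {B C : Set X} {κ κ' γ : Set S} {x y : X}

theorem bumpFilter_neBot (h : IsRieszSystem 𝓚 𝓖 𝓑 F T) (hB : B ∈ 𝓑) (hx : x ∈ B) (hκ : κ ∈ 𝓚) :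
    (bumpFilter 𝓚 𝓖 F B κ x).NeBot := by
  refine h.isPaving.hasBasis_bumpFilter.neBot_iff.2 fun {γ} hγ => ?_
  obtain ⟨f, hf, hfγ, hfκ⟩ := h.exists_bump κ hκ γ hγ.1 hγ.2 x
  exact ⟨f, inRange_mono (hull_subset hB hx) hf, hfκ, hfγ⟩

theorem tendsto_add_bumpFilter (h : IsRieszSystem 𝓚 𝓖 𝓑 F T)
    (hadd : ∀ b ∈ B, ∀ b' ∈ B, b + b' ∈ C) :
    Tendsto (fun p : F × F => p.1 + p.2) (bumpFilter 𝓚 𝓖 F B κ x ×ˢ bumpFilter 𝓚 𝓖 F B κ y)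
      (bumpFilter 𝓚 𝓖 F C κ (x + y)) := by
  have hp := h.isPaving
  refine hp.hasBasis_bumpFilter.tendsto_right_iff.2 fun γ hγ => ?_
  filter_upwards [prod_mem_prod (hp.hasBasis_bumpFilter.mem_of_mem hγ)
    (hp.hasBasis_bumpFilter.mem_of_mem hγ)]
  rintro ⟨f, g⟩ ⟨⟨hf, ⟨ω, hω, hκω, hfω⟩, hfγ⟩, hg, ⟨ω', hω', hκω', hgω'⟩, hgγ⟩
  refine ⟨add_mem_inRange hadd hf hg, ⟨ω ∩ ω', hp.G_inter ω hω ω' hω', Set.subset_inter hκω hκω',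
    fun s hs => ?_⟩, Set.union_self γ ▸ h.supportedBy_add hfγ hgγ⟩
  rw [AddSubmonoid.coe_add, Pi.add_apply, hfω s hs.1, hgω' s hs.2]

theorem add_mem_bumps_of_disjoint (h : IsRieszSystem 𝓚 𝓖 𝓑 F T) {γ' : Set S} (hγ : γ ∈ 𝓖)
    (hγ' : γ' ∈ 𝓖) (hd : Disjoint γ γ') (hκγ : κ ⊆ γ) (hκγ' : κ' ⊆ γ') {f g : F}
    (hf : f ∈ bumps 𝓚 𝓖 F B κ γ x) (hg : g ∈ bumps 𝓚 𝓖 F B κ' γ' x) :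
    f + g ∈ bumps 𝓚 𝓖 F B (κ ∪ κ') (γ ∪ γ') x := by
  have hp := h.isPaving
  obtain ⟨hf, ⟨ω, hω, hκω, hfω⟩, hfγ⟩ := hf
  obtain ⟨hg, ⟨ω', hω', hκω', hgω'⟩, hgγ'⟩ := hg
  refine ⟨add_mem_inRange_of_disjoint hd hf hg hfγ hgγ',
    ⟨ω ∩ γ ∪ ω' ∩ γ', hp.G_union _ (hp.G_inter ω hω γ hγ) _ (hp.G_inter ω' hω' γ' hγ'),
      Set.union_subset_union (Set.subset_inter hκω hκγ) (Set.subset_inter hκω' hκγ'), ?_⟩,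
    h.supportedBy_add hfγ hgγ'⟩
  rintro s (⟨hsω, hsγ⟩ | ⟨hsω, hsγ⟩) <;> rw [AddSubmonoid.coe_add, Pi.add_apply]
  · rw [hfω s hsω, hgγ'.eq_zero (Set.disjoint_left.1 hd hsγ), add_zero]
  · rw [hgω' s hsω, hfγ.eq_zero (Set.disjoint_right.1 hd hsγ), zero_add]

end IsRieszSystem

namespace IsRieszIntegral

variable [UniformSpace X] [AddCommMonoid X] [UniformSpace Z] [AddCommMonoid Z]
  {𝓚 𝓖 : Set (Set S)} {𝓑 : Set (Set X)} {F : AddSubmonoid (S → X)} {T : UniformSpace F}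
  {ℓ : F → Z} {B : Set X} {W : Set (Z × Z)} {κ : Set S} {x : X}

theorem exists_map_bumps_mem (h : IsRieszIntegral 𝓚 𝓖 𝓑 F T ℓ) (hB : B ∈ 𝓑) (hW : W ∈ 𝓤 Z) :
    ∃ V ∈ integralFilter 𝓚 𝓖 𝓑 ℓ, ∀ κ ∈ 𝓚, ∀ γ ∈ 𝓖, κ ⊆ γ → γ \ κ ∈ V →
      ∀ x, ∀ f ∈ bumps 𝓚 𝓖 F B κ γ x, ∀ g ∈ bumps 𝓚 𝓖 F B κ γ x, (ℓ f, ℓ g) ∈ W := by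
  have hs := h.system
  obtain ⟨C, hC, V, hV, hmap⟩ := h.exists_map_add_mem hB hW
  refine ⟨_, smallSets_mem_smallnessFilter _ hC hV, fun κ hκ γ hγ hκγ hsmall x => ?_⟩
  rintro f ⟨hf, ⟨ω, hω, hκω, hfω⟩, hfγ⟩ g ⟨hg, ⟨ω', hω', hκω', hgω'⟩, hgγ⟩
  have hfg := hmap κ hκ γ hγ hκγ hsmall 0 (hs.zero_mem_inRange hB) f hf g hg hfγ hgγ
    ⟨ω ∩ ω', hs.isPaving.G_inter ω hω ω' hω', Set.subset_inter hκω hκω',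
      fun s hsω => (hfω s hsω.1).trans (hgω' s hsω.2).symm⟩
  rwa [zero_add, zero_add] at hfg

theorem cauchy_map_bumpFilter (h : IsRieszIntegral 𝓚 𝓖 𝓑 F T ℓ) (hB : B ∈ 𝓑) (hx : x ∈ B)
    (hκ : κ ∈ 𝓚) : Cauchy (map ℓ (bumpFilter 𝓚 𝓖 F B κ x)) := by
  have := h.system.bumpFilter_neBot hB hx hκ
  refine cauchy_map_of_forall_exists fun W hW => ?_
  obtain ⟨V, hV, hmap⟩ := h.exists_map_bumps_mem hB hW
  obtain ⟨γ, hγ, hκγ, hsmall⟩ := h.isRegularPaving.outer κ hκ V hV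
  have hbumps : bumps 𝓚 𝓖 F B κ γ x ∈ bumpFilter 𝓚 𝓖 F B κ x :=
    h.system.isPaving.hasBasis_bumpFilter.mem_of_mem ⟨hγ, hκγ⟩
  obtain ⟨f, hf⟩ := nonempty_of_mem hbumps
  exact ⟨ℓ f, mem_of_superset hbumps fun g hg => hmap κ hκ γ hγ hκγ hsmall x f hf g hg⟩

theorem tauFilter_neBot (h : IsRieszIntegral 𝓚 𝓖 𝓑 F T ℓ) (hκ : κ ∈ 𝓚) (x : X) :
    (tauFilter 𝓚 𝓖 𝓑 ℓ κ x).NeBot := by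
  rw [h.system.isPaving.tauFilter_eq_map]
  exact (h.system.bumpFilter_neBot (h.system.hull_mem x) (mem_hull 𝓑 x) hκ).map ℓ

theorem tauFilter_le_principal (h : IsRieszIntegral 𝓚 𝓖 𝓑 F T ℓ) (κ : Set S) (x : X) :
    tauFilter 𝓚 𝓖 𝓑 ℓ κ x ≤ 𝓟 (closure (ℓ '' inRange F (hull 𝓑 x))) := by
  have hp := h.system.isPaving
  rw [hp.tauFilter_eq_map, le_principal_iff]
  exact mem_of_superset
    (image_mem_map (hp.hasBasis_bumpFilter.mem_of_mem ⟨hp.G_univ, κ.subset_univ⟩))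
    ((Set.image_mono fun f hf => hf.1).trans subset_closure)

theorem tauFilter_le_nhds_tau (h : IsRieszIntegral 𝓚 𝓖 𝓑 F T ℓ) (hκ : κ ∈ 𝓚) (x : X) :
    tauFilter 𝓚 𝓖 𝓑 ℓ κ x ≤ 𝓝 (tau 𝓚 𝓖 𝓑 ℓ κ x) := by
  have hx := h.system.hull_mem x
  have hcauchy : Cauchy (tauFilter 𝓚 𝓖 𝓑 ℓ κ x) := by
    rw [h.system.isPaving.tauFilter_eq_map]
    exact h.cauchy_map_bumpFilter hx (mem_hull 𝓑 x) hκ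
  obtain ⟨z, -, hz⟩ := h.relComplete _ hx _ hcauchy (h.tauFilter_le_principal κ x)
  exact le_nhds_lim ⟨z, hz⟩

theorem tendsto_bumpFilter (h : IsRieszIntegral 𝓚 𝓖 𝓑 F T ℓ) (hB : B ∈ 𝓑) (hx : x ∈ B)
    (hκ : κ ∈ 𝓚) : Tendsto ℓ (bumpFilter 𝓚 𝓖 F B κ x) (𝓝 (tau 𝓚 𝓖 𝓑 ℓ κ x)) := by
  have := h.tauFilter_neBot hκ x
  refine le_nhds_of_cauchy_adhp (h.cauchy_map_bumpFilter hB hx hκ)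
    ((ClusterPt.of_le_nhds (h.tauFilter_le_nhds_tau hκ x)).mono ?_)
  rw [h.system.isPaving.tauFilter_eq_map]
  exact map_mono (bumpFilter_mono (hull_subset hB hx))

theorem tau_mem_closure (h : IsRieszIntegral 𝓚 𝓖 𝓑 F T ℓ) (hκ : κ ∈ 𝓚) (x : X) :
    tau 𝓚 𝓖 𝓑 ℓ κ x ∈ closure (ℓ '' inRange F (hull 𝓑 x)) :=
  have := h.tauFilter_neBot hκ x
  isClosed_closure.mem_of_tendsto (f := id) (b := tauFilter 𝓚 𝓖 𝓑 ℓ κ x)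
    (h.tauFilter_le_nhds_tau hκ x) (le_principal_iff.1 (h.tauFilter_le_principal κ x))

theorem exists_tau_mem (h : IsRieszIntegral 𝓚 𝓖 𝓑 F T ℓ) (hB : B ∈ 𝓑) (hW : W ∈ 𝓤 Z) :
    ∃ V ∈ integralFilter 𝓚 𝓖 𝓑 ℓ, ∀ κ ∈ 𝓚, ∀ γ ∈ 𝓖, κ ⊆ γ → γ \ κ ∈ V →
      ∀ x ∈ B, ∀ f ∈ bumps 𝓚 𝓖 F B κ γ x, (tau 𝓚 𝓖 𝓑 ℓ κ x, ℓ f) ∈ W := by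
  obtain ⟨W', ⟨hW', hclosed⟩, hW'W⟩ := uniformity_hasBasis_closed.mem_iff.1 hW
  obtain ⟨V, hV, hmap⟩ := h.exists_map_bumps_mem hB hW'
  refine ⟨V, hV, fun κ hκ γ hγ hκγ hsmall x hx f hf => hW'W ?_⟩
  have := h.system.bumpFilter_neBot hB hx hκ
  refine hclosed.mem_of_tendsto ((h.tendsto_bumpFilter hB hx hκ).prodMk_nhds tendsto_const_nhds) ?_
  filter_upwards [h.system.isPaving.hasBasis_bumpFilter.mem_of_mem ⟨hγ, hκγ⟩] with g hg
  exact hmap κ hκ γ hγ hκγ hsmall x g hg f hf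

theorem closeOnSmallDiff_tau (h : IsRieszIntegral 𝓚 𝓖 𝓑 F T ℓ) :
    CloseOnSmallDiff (integralFilter 𝓚 𝓖 𝓑 ℓ) 𝓚 𝓚 (tau 𝓚 𝓖 𝓑 ℓ) (tau 𝓚 𝓖 𝓑 ℓ) := by
  refine closeOnSmallDiff_pi fun x W hW => ?_
  have hB := h.system.hull_mem x
  have hx := mem_hull 𝓑 x
  obtain ⟨W', hW', hsymm, hW'W⟩ := comp_symm_mem_uniformity_sets hW
  obtain ⟨V, hV, htau⟩ := h.exists_tau_mem hB hW'
  obtain ⟨U, hU, hUV⟩ := h.isRegularPaving.exists_union V hV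
  refine ⟨U, hU, fun κ hκ κ' hκ' hκκ' hdiff => ?_⟩
  obtain ⟨γ, hγ, hκ'γ, hγU⟩ := h.isRegularPaving.outer κ' hκ' U hU
  obtain ⟨f, hf, hfγ, hfκ'⟩ := h.system.exists_bump κ' hκ' γ hγ hκ'γ x
  have hf : f ∈ bumps 𝓚 𝓖 F (hull 𝓑 x) κ' γ x := ⟨hf, hfκ', hfγ⟩
  have hγκ' : γ \ κ' ∈ V := hUV _ hγU _ hγU _ Set.subset_union_left
  have hγκ : γ \ κ ∈ V := hUV _ hγU _ hdiff _ fun s hs =>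
    (em (s ∈ κ')).symm.imp (fun hs' => ⟨hs.1, hs'⟩) fun hs' => ⟨hs', hs.2⟩
  exact hW'W ⟨ℓ f, htau κ hκ γ hγ (hκκ'.trans hκ'γ) hγκ x hx f
      (bumps_mono subset_rfl hκκ' subset_rfl hf),
    hsymm.symm _ _ (htau κ' hκ' γ hγ hκ'γ hγκ' x hx f hf)⟩

theorem add_mem_increments (h : IsRieszIntegral 𝓚 𝓖 𝓑 F T ℓ) {γ ω ω' : Set S} (hω : ω ∈ 𝓖)
    (hω' : ω' ∈ 𝓖) (hd : Disjoint ω ω') (hωγ : ω ⊆ γ) (hω'γ : ω' ⊆ γ) {p q : Z × Z}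
    (hp : p ∈ increments 𝓚 ℓ B ω) (hq : q ∈ increments 𝓚 ℓ B ω') :
    p + q ∈ increments 𝓚 ℓ B γ := by
  obtain ⟨f, ⟨hf, hfω⟩, g, ⟨hg, hgω⟩, rfl⟩ := hp
  obtain ⟨f', ⟨hf', hfω'⟩, g', ⟨hg', hgω'⟩, rfl⟩ := hq
  have hωω' := Set.union_subset hωγ hω'γ
  refine ⟨f + f', ⟨add_mem_inRange_of_disjoint hd hf hf' hfω hfω',
      (h.system.supportedBy_add hfω hfω').mono hωω'⟩,
    g + g', ⟨add_mem_inRange_of_disjoint hd hg hg' hgω hgω',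
      (h.system.supportedBy_add hgω hgω').mono hωω'⟩, ?_⟩
  have hfg := Set.union_self ω ▸ h.system.supportedBy_add hfω hgω
  have hfg' := Set.union_self ω' ▸ h.system.supportedBy_add hfω' hgω'
  simp only [Prod.mk_add_mk]
  rw [add_add_add_comm f f' g g', h.map_add _ _ (separated_of_disjoint hω hω' hd hfω hfω'),
    h.map_add _ _ (separated_of_disjoint hω hω' hd hfg hfg')]

theorem tau_mem_closure_increments (h : IsRieszIntegral 𝓚 𝓖 𝓑 F T ℓ) (hB : B ∈ 𝓑) (hκ : κ ∈ 𝓚)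
    {γ : Set S} (hγ : γ ∈ 𝓖) (hκγ : κ ⊆ γ) {y : X} (hx : x ∈ B) (hy : y ∈ B) :
    (tau 𝓚 𝓖 𝓑 ℓ κ x, tau 𝓚 𝓖 𝓑 ℓ κ (x + y)) ∈ closure (increments 𝓚 ℓ B γ) := by
  obtain ⟨C, hC, -, hadd⟩ := h.system.exists_add hB
  have := h.system.bumpFilter_neBot hB hx hκ
  have := h.system.bumpFilter_neBot hB hy hκ
  have hbasis {z : X} := (h.system.isPaving.hasBasis_bumpFilter (F := F) (B := B) (x := z))
    |>.mem_of_mem ⟨hγ, hκγ⟩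
  refine mem_closure_of_tendsto (((h.tendsto_bumpFilter hB hx hκ).comp tendsto_fst).prodMk_nhds
    ((h.tendsto_bumpFilter hC (hadd x hx y hy) hκ).comp (h.system.tendsto_add_bumpFilter hadd))) ?_
  filter_upwards [prod_mem_prod hbasis hbasis] with p hp
  exact ⟨p.1, ⟨hp.1.1, hp.1.2.2⟩, p.2, ⟨hp.2.1, hp.2.2.2⟩, rfl⟩

section IsUniformAddCommMonoid

variable [IsUniformAddCommMonoid Z]

theorem sum_tau_mem_closure_increments (h : IsRieszIntegral 𝓚 𝓖 𝓑 F T ℓ) (hB : B ∈ 𝓑)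
    {K : Finset (Set S)} (hK : (K : Set (Set S)) ⊆ 𝓚) (hd : (K : Set (Set S)).PairwiseDisjoint id)
    {γ : Set S} (hγ : γ ∈ 𝓖) (hKγ : ⋃₀ (K : Set (Set S)) ⊆ γ) {x y : Set S → X}
    (hx : ∀ κ ∈ K, x κ ∈ B) (hy : ∀ κ ∈ K, y κ ∈ B) :
    (∑ κ ∈ K, tau 𝓚 𝓖 𝓑 ℓ κ (x κ), ∑ κ ∈ K, tau 𝓚 𝓖 𝓑 ℓ κ (x κ + y κ)) ∈
      closure (increments 𝓚 ℓ B γ) := by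
  classical
  have hs := h.system
  induction K using Finset.induction_on generalizing γ with
  | empty =>
    have hzero := And.intro (hs.zero_mem_inRange hB) (hs.supportedBy_zero γ)
    exact subset_closure ⟨0, hzero, 0, hzero, by simp [h.map_zero]⟩
  | insert κ K hκK ih =>
    rw [Finset.coe_insert] at hK hd hKγ
    rw [Set.sUnion_insert] at hKγ
    rw [Set.insert_subset_iff] at hK
    rw [Finset.forall_mem_insert] at hx hy
    have hdκ : Disjoint κ (⋃₀ (K : Set (Set S))) := Set.disjoint_sUnion_right.2 fun κ' hκ' =>
      hd (Set.mem_insert _ _) (Set.mem_insert_of_mem _ hκ') fun heq => hκK (heq ▸ hκ')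
    obtain ⟨ω, hω, ω', hω', hκω, hKω', hdω, hωγ, hω'γ⟩ := hs.isPaving.exists_disjoint_nhds hK.1
      (hs.K_sUnion _ hK.2 K.finite_toSet) hγ hdκ (Set.subset_union_left.trans hKγ)
      (Set.subset_union_right.trans hKγ)
    rw [Finset.sum_insert hκK, Finset.sum_insert hκK, ← Prod.mk_add_mk]
    exact map_mem_closure₂ continuous_add
      (h.tau_mem_closure_increments hB hK.1 hω hκω hx.1 hy.1)
      (ih hK.2 (hd.subset (Set.subset_insert _ _)) hω' hKω' hx.2 hy.2)
      fun p hp q hq => h.add_mem_increments hω hω' hdω hωγ hω'γ hp hq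

theorem integralFilter_le_contentFilter (h : IsRieszIntegral 𝓚 𝓖 𝓑 F T ℓ) :
    integralFilter 𝓚 𝓖 𝓑 ℓ ≤ contentFilter 𝓚 𝓖 𝓑 (tau 𝓚 𝓖 𝓑 ℓ) := by
  refine (hasBasis_contentFilter h.system.directedOn h.system.nonempty).ge_iff.2 ?_
  rintro ⟨B, W⟩ ⟨hB, hW⟩
  obtain ⟨W', ⟨hW', hclosed⟩, hW'W⟩ := uniformity_hasBasis_closed.mem_iff.1 hW
  refine mem_of_superset (smallSets_mem_smallnessFilter _ hB hW') ?_
  rintro α ⟨γ, ⟨hγ, hsmall⟩, hαγ⟩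
  have hincr : increments 𝓚 ℓ B γ ⊆ W' :=
    Set.image2_subset_iff.2 fun f hf g hg => hsmall f hf.1 g hg.1 hg.2
  exact ⟨γ, hγ, hαγ, fun K hK hd hKγ x y hx hy =>
    hW'W (closure_minimal hincr hclosed (h.sum_tau_mem_closure_increments hB hK hd hγ hKγ hx hy))⟩

theorem isAlmostCompact_contentFilter (h : IsRieszIntegral 𝓚 𝓖 𝓑 F T ℓ)
    (hbdd : GBounded 𝓚 𝓖 𝓑 ℓ) : IsAlmostCompact 𝓚 𝓖 (contentFilter 𝓚 𝓖 𝓑 (tau 𝓚 𝓖 𝓑 ℓ)) :=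
  fun V hV => hbdd.isAlmostCompact h.system.directedOn h.system.nonempty V
    (h.integralFilter_le_contentFilter hV)

end IsUniformAddCommMonoid

section T2Space

variable [T2Space Z]

theorem tau_eq_zero (h : IsRieszIntegral 𝓚 𝓖 𝓑 F T ℓ) (hκ : κ ∈ 𝓚)
    (hzero : EqualsOver 𝓖 ((0 : F) : S → X) x κ) : tau 𝓚 𝓖 𝓑 ℓ κ x = 0 := by
  have hB := h.system.hull_mem x
  have hpure : pure 0 ≤ bumpFilter 𝓚 𝓖 F (hull 𝓑 x) κ x := le_iInf₂ fun γ _ => by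
    rw [le_principal_iff, mem_pure]
    exact ⟨h.system.zero_mem_inRange hB, hzero, h.system.supportedBy_zero γ⟩
  have hlim := (h.tendsto_bumpFilter hB (mem_hull 𝓑 x) hκ).mono_left hpure
  rw [tendsto_pure_left] at hlim
  rw [← h.map_zero]
  exact (pure_le_nhds_iff.1 fun s hs => hlim s hs).symm

theorem tau_apply_zero (h : IsRieszIntegral 𝓚 𝓖 𝓑 F T ℓ) (hκ : κ ∈ 𝓚) :
    tau 𝓚 𝓖 𝓑 ℓ κ 0 = 0 :=
  h.tau_eq_zero hκ ⟨Set.univ, h.system.isPaving.G_univ, κ.subset_univ, fun _ _ => rfl⟩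

theorem tau_empty (h : IsRieszIntegral 𝓚 𝓖 𝓑 F T ℓ) : tau 𝓚 𝓖 𝓑 ℓ ∅ = 0 :=
  funext fun _ => h.tau_eq_zero h.system.isPaving.K_empty
    ⟨∅, Set.sUnion_empty ▸ h.system.G_sUnion ∅ (Set.empty_subset _) Set.finite_empty,
      subset_rfl, fun _ hs => hs.elim⟩

variable [IsUniformAddCommMonoid Z]

theorem tau_union (h : IsRieszIntegral 𝓚 𝓖 𝓑 F T ℓ) {κ κ' : Set S} (hκ : κ ∈ 𝓚) (hκ' : κ' ∈ 𝓚)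
    (hd : Disjoint κ κ') :
    tau 𝓚 𝓖 𝓑 ℓ (κ ∪ κ') = tau 𝓚 𝓖 𝓑 ℓ κ + tau 𝓚 𝓖 𝓑 ℓ κ' := by
  have hp := h.system.isPaving
  funext x
  have hB := h.system.hull_mem x
  have hx := mem_hull 𝓑 x
  have := h.system.bumpFilter_neBot hB hx hκ
  have := h.system.bumpFilter_neBot hB hx hκ'
  let l := bumpFilter 𝓚 𝓖 F (hull 𝓑 x) κ x ×ˢ bumpFilter 𝓚 𝓖 F (hull 𝓑 x) κ' x
  have hnhds {γ : Set S} (hγ : γ ∈ 𝓖) (hκγ : κ ∪ κ' ⊆ γ) : ∀ᶠ p in l,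
      p.1 + p.2 ∈ bumps 𝓚 𝓖 F (hull 𝓑 x) (κ ∪ κ') γ x ∧ ℓ (p.1 + p.2) = ℓ p.1 + ℓ p.2 := by
    obtain ⟨ω, hω, ω', hω', hκω, hκω', hdω, hωγ, hω'γ⟩ := hp.exists_disjoint_nhds hκ hκ' hγ hd
      (Set.subset_union_left.trans hκγ) (Set.subset_union_right.trans hκγ)
    filter_upwards [prod_mem_prod (hp.hasBasis_bumpFilter.mem_of_mem ⟨hω, hκω⟩)
      (hp.hasBasis_bumpFilter.mem_of_mem ⟨hω', hκω'⟩)] with p hp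
    exact ⟨bumps_mono subset_rfl subset_rfl (Set.union_subset hωγ hω'γ)
        (h.system.add_mem_bumps_of_disjoint hω hω' hdω hκω hκω' hp.1 hp.2),
      h.map_add p.1 p.2 (separated_of_disjoint hω hω' hdω hp.1.2.2 hp.2.2.2)⟩
  have hsum : Tendsto (fun p : F × F => p.1 + p.2) l
      (bumpFilter 𝓚 𝓖 F (hull 𝓑 x) (κ ∪ κ') x) :=
    hp.hasBasis_bumpFilter.tendsto_right_iff.2 fun γ hγ => (hnhds hγ.1 hγ.2).mono fun _ => And.left
  exact tendsto_nhds_unique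
    ((h.tendsto_bumpFilter hB hx (hp.K_union κ hκ κ' hκ')).comp hsum)
    ((((h.tendsto_bumpFilter hB hx hκ).comp tendsto_fst).add
      ((h.tendsto_bumpFilter hB hx hκ').comp tendsto_snd)).congr'
      ((hnhds hp.G_univ (Set.subset_univ _)).mono fun _ hp => hp.2.symm))

theorem isTightContent_tau (h : IsRieszIntegral 𝓚 𝓖 𝓑 F T ℓ) :
    IsTightContent 𝓚 𝓖 (integralFilter 𝓚 𝓖 𝓑 ℓ) (tau 𝓚 𝓖 𝓑 ℓ) where
  toIsRegularPaving := h.isRegularPaving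
  map_empty := h.tau_empty
  map_union _ hκ _ hκ' := h.tau_union hκ hκ'
  close := h.closeOnSmallDiff_tau
  complete := ⟨_, isComplete_univ_pi fun x => h.relComplete _ (h.system.hull_mem x),
    fun _ hκ x _ => h.tau_mem_closure hκ x⟩

theorem isTightContent_tau_contentFilter (h : IsRieszIntegral 𝓚 𝓖 𝓑 F T ℓ) :
    IsTightContent 𝓚 𝓖 (contentFilter 𝓚 𝓖 𝓑 (tau 𝓚 𝓖 𝓑 ℓ)) (tau 𝓚 𝓖 𝓑 ℓ) :=
  h.isTightContent_tau.coarsen_contentFilter h.system.directedOn (fun _ => h.tau_apply_zero)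
    h.system.zero_mem_B h.system.B_cover h.integralFilter_le_contentFilter

end T2Space

end IsRieszIntegral

end RieszRep

theorem theorem5p7_general {S X Z : Type*}
    [UniformSpace X] [AddCommMonoid X] [UniformSpace Z] [AddCommMonoid Z]
    [IsUniformAddCommMonoid Z] [T2Space Z]
    (𝓚 𝓖 : Set (Set S)) (𝓑 : Set (Set X)) (F : AddSubmonoid (S → X)) (T : UniformSpace F)
    (ℓ : F → Z)
    (hint : RieszRep.IsRieszIntegral 𝓚 𝓖 𝓑 F T ℓ)
    (hbdd : RieszRep.GBounded 𝓚 𝓖 𝓑 ℓ) :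
    RieszRep.NuWellDefined 𝓚 𝓖 𝓑 ℓ ∧
    𝓚 ∪ 𝓖 ⊆ RieszRep.regularSets 𝓚 𝓖 𝓑 (RieszRep.nu 𝓚 𝓖 𝓑 ℓ) ∧
    RieszRep.IsCountablyAdditiveOn (RieszRep.nu 𝓚 𝓖 𝓑 ℓ)
      (RieszRep.regularSets 𝓚 𝓖 𝓑 (RieszRep.nu 𝓚 𝓖 𝓑 ℓ)) := by
  have h := hint.isTightContent_tau_contentFilter
  have hnu : ∀ κ ∈ 𝓚, RieszRep.nu 𝓚 𝓖 𝓑 ℓ κ = RieszRep.tau 𝓚 𝓖 𝓑 ℓ κ := fun _ => h.extension_eq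
  rw [RieszRep.regularSets_congr hnu, RieszRep.regularSets_eq_approximableSets
    hint.system.directedOn hint.system.nonempty h.toIsRegularPaving]
  exact ⟨{
      tauFilter_neBot := fun _ => hint.tauFilter_neBot
      tau_lim := fun _ => hint.tauFilter_le_nhds_tau
      xi_lim := fun _ => h.tendsto_innerLimit
      nu_lim := h.tendsto_extension },
    Set.union_subset (fun _ => h.mem_approximableSets_of_mem_K) h.inner,
    h.isCountablyAdditiveOn_extension (hint.isAlmostCompact_contentFilter hbdd)⟩

theorem theorem5p7 {S X Z : Type*}
    [UniformSpace X] [AddCommMonoid X] [IsUniformAddCommMonoid X]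
    [UniformSpace Z] [AddCommMonoid Z] [IsUniformAddCommMonoid Z] [T2Space Z]
    (𝓚 𝓖 : Set (Set S)) (𝓑 : Set (Set X)) (F : AddSubmonoid (S → X)) (T : UniformSpace F)
    (ℓ : F → Z)
    (hint : RieszRep.IsRieszIntegral 𝓚 𝓖 𝓑 F T ℓ)
    (hbdd : RieszRep.GBounded 𝓚 𝓖 𝓑 ℓ) :
    RieszRep.NuWellDefined 𝓚 𝓖 𝓑 ℓ ∧
    𝓚 ∪ 𝓖 ⊆ RieszRep.regularSets 𝓚 𝓖 𝓑 (RieszRep.nu 𝓚 𝓖 𝓑 ℓ) ∧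
    RieszRep.IsCountablyAdditiveOn (RieszRep.nu 𝓚 𝓖 𝓑 ℓ)
      (RieszRep.regularSets 𝓚 𝓖 𝓑 (RieszRep.nu 𝓚 𝓖 𝓑 ℓ)) :=
  theorem5p7_general 𝓚 𝓖 𝓑 F T ℓ hint hbdd
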